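/- **Setting.** Let $(\Omega,\mathcal F,P)$ be a probability space. A sub-σ-field of $\mathcal F$ always means one that contains all events of probability $0$ (sub-σ-fields are taken modulo null sets); $\mathcal A\otimes\mathcal B$ denotes the σ-field generated by $\mathcal A$ and $\mathcal B$ and asserts that they are independent. A *continuous factorization* consists of $(\Omega,\mathcal F,P)$ and sub-σ-fields $(\mathcal F_{s,t})_{s\le t}$, $s,t\in\mathbb R$, such that (a) $\mathcal F_{r,t}=\mathcal F_{r,s}\otimes\mathcal F_{s,t}$ whenever $r\le s\le t$; (b) $\bigcup_{\varepsilon>0,\ s+\varepsilon\le t-\varepsilon}\mathcal F_{s+\varepsilon,t-\varepsilon}$ generates $\mathcal F_{s,t}$ whenever $s<t$; (c) $\bigcup_{n\ge1}\mathcal F_{-n,n}$ generates $\mathcal F$. Let $\mathcal C$ be the space of all compact subsets of $\mathbb R$ (including $\emptyset$), with the Borel σ-field of the Hausdorff metric ($\emptyset$ being an isolated point). For an elementary set $E\subset\mathbb R$ (a finite union of intervals, bounded or not), let $\mathcal F_E$ be the σ-field generated by all $\mathcal F_{s,t}$ with $(s,t)\subset E$. The *spectral measure* $\mu_f$ of $f\in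 L_2(\Omega,\mathcal F,P)$ is the unique measure on $\mathcal C$ such that $\mu_f(\{M\in\mathcal C: M\subset E\})=\|\mathbb E(f\mid\mathcal F_E)\|^2$ for all elementary $E$. A set $I\subset\mathcal C$ is an *ideal* if $M_1\subset M_2\in I$ implies $M_1\in I$, and $M_1,M_2\in I$ implies $M_1\cup M_2\in I$; it is *shift-invariant* if $M\in I$ implies $M+t\in I$ for all $t\in\mathbb R$. A *noise* is a continuous factorization together with measure preserving maps $\alpha_t:\Omega\to\Omega$, $t\in\mathbb R$, such that $\alpha_0=\mathrm{id}$ and $\alpha_{s+t}=\alpha_s\circ\alpha_t$ almost surely, $\alpha_t^{-1}(\mathcal F_{r,s})=\mathcal F_{r-t,s-t}$ modulo null sets for all $t$ and all $r\le s$, and $P(A\bigtriangleup\alpha_t^{-1}(A))\to0$ as $t\to0$ for every $A\in\mathcal F$. A continuous factorization is *classical* if every $\mu_f$, $f\in L_2$, is concentrated on the set $\mathcal C_{\text{finite}}$ of finite sets. **Theorem 6.15.** 1. Let $((\Omega,\mathcal F,P),(\mathcal F_{s,t})_{s\le t})$ be a continuous factorization, $I\subset\mathcal C$ a Borel ideal,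 and $\mathcal E\subset\mathcal F$ a sub-σ-field such that every $f\in L_2(\Omega,\mathcal F,P)$ is $\mathcal E$-measurable if and only if $\mu_f$ is concentrated on $I$. Then the sub-σ-fields $\mathcal E_{s,t}=\mathcal E\cap\mathcal F_{s,t}$ satisfy (a), (b), (c) with $\mathcal E$ in place of $\mathcal F$; that is, they form a continuous factorization of the quotient probability space $(\Omega,\mathcal E,P|_{\mathcal E})$. 2. If, in addition, $(\alpha_t)_{t\in\mathbb R}$ makes the given factorization a noise and $I$ is shift-invariant, then $(\Omega,\mathcal E,P|_{\mathcal E})$ with $(\mathcal E_{s,t})_{s\le t}$ and the same $(\alpha_t)_{t\in\mathbb R}$ is a noise (a sub-noise of the given one). 3. In particular, every noise has its classical sub-noise: there is a sub-σ-field $\mathcal E\subset\mathcal F$ such that $f\in L_2(\Omega,\mathcal F,P)$ is $\mathcal E$-measurable if and only if $\mu_f$ is concentrated on $\mathcal C_{\text{finite}}$, and $(\Omega,\mathcal E,P|_{\mathcal E})$ with $\mathcal E_{s,t}=\mathcal E\cap\mathcal F_{s,t}$ and $(\alpha_t)$ is a noise whose factorization is classical. -/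

import Mathlib

open MeasureTheory ProbabilityTheory TopologicalSpace Filter Topology

namespace ContFact

/-- The Borel σ-field of the space of all compact subsets of `ℝ` (the empty set included); the
topology is the one of the Hausdorff distance, with the empty set as an isolated point. -/
instance instMeasurableSpaceCompacts : MeasurableSpace (Compacts ℝ) := borel (Compacts ℝ)

instance instBorelSpaceCompacts : BorelSpace (Compacts ℝ) := ⟨rfl⟩

variable {Ω : Type*}

/-- `m` is a sub-σ-field of the σ-field of `P`, containing all events of probability zero
(that is, sub-σ-fields are understood modulo null sets). -/
structure IsSubSigmaField {mΩ : MeasurableSpace Ω} (P : Measure Ω) (m : MeasurableSpace Ω) :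
    Prop where
  le : m ≤ mΩ
  null : ∀ N : Set Ω, MeasurableSet[mΩ] N → P N = 0 → MeasurableSet[m] N

/-- The least σ-field that contains `m` and all events of probability zero: all events that
are almost surely equal to some set of `m`. -/
@[reducible] def nullCompletion {mΩ : MeasurableSpace Ω} (P : Measure Ω) (m : MeasurableSpace Ω) :
    MeasurableSpace Ω :=
  eventuallyMeasurableSpace m (ae P) ⊓ mΩ

/-- A continuous factorization `((Ω, mΩ, P), (F s t)_{s ≤ t})`. Only the values `F s t` with
`s ≤ t` matter. -/
structure IsContinuousFactorization {mΩ : MeasurableSpace Ω} (P : Measure Ω)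
    (F : ℝ → ℝ → MeasurableSpace Ω) : Prop where
  prob : IsProbabilityMeasure P
  sub : ∀ s t : ℝ, s ≤ t → IsSubSigmaField P (F s t)
  indep : ∀ r s t : ℝ, r ≤ s → s ≤ t → Indep (F r s) (F s t) P
  sup : ∀ r s t : ℝ, r ≤ s → s ≤ t → F r s ⊔ F s t = F r t
  inner : ∀ s t : ℝ, s < t →
    (⨆ (ε : ℝ) (_ : 0 < ε ∧ s + ε ≤ t - ε), F (s + ε) (t - ε)) = F s t
  exhaust : (⨆ (n : ℕ) (_ : 1 ≤ n), F (-(n : ℝ)) (n : ℝ)) = mΩ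

/-- Elementary sets: finite unions of intervals (bounded or not, with or without endpoints,
degenerate intervals allowed). -/
def IsElementary (E : Set ℝ) : Prop :=
  ∃ S : Set (Set ℝ), S.Finite ∧ (∀ J ∈ S, J.OrdConnected) ∧ E = ⋃₀ S

/-- The σ-field `F_E`, generated by all `F s t` with `(s, t) ⊆ E`. In a continuous factorization,
if `E` is, up to a finite set, the disjoint union of intervals `(s₁, t₁), …, (sₙ, tₙ)`, then it is
`F s₁ t₁ ⊗ ⋯ ⊗ F sₙ tₙ`. -/
@[reducible] def sigmaField (F : ℝ → ℝ → MeasurableSpace Ω) (E : Set ℝ) : MeasurableSpace Ω :=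
  ⨆ (s : ℝ) (t : ℝ) (_ : s ≤ t ∧ Set.Ioo s t ⊆ E), F s t

/-- `μ` is the spectral measure of the square integrable random variable `f`: the measure of
`{M : M ⊆ E}` is the squared `L₂`-norm of the conditional expectation of `f` given `F_E`, for every
elementary set `E`. -/
def IsSpectralMeasure {mΩ : MeasurableSpace Ω} (P : Measure Ω) (F : ℝ → ℝ → MeasurableSpace Ω)
    (f : Ω → ℝ) (μ : Measure (Compacts ℝ)) : Prop :=
  ∀ E : Set ℝ, IsElementary E →
    μ {M : Compacts ℝ | (M : Set ℝ) ⊆ E} = eLpNorm (condExp (sigmaField F E) P f) 2 P ^ 2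

/-- The spectral measure of `f` is concentrated on `I`. -/
def SpectrumIn {mΩ : MeasurableSpace Ω} (P : Measure Ω) (F : ℝ → ℝ → MeasurableSpace Ω)
    (f : Ω → ℝ) (I : Set (Compacts ℝ)) : Prop :=
  ∃ μ : Measure (Compacts ℝ), IsSpectralMeasure P F f μ ∧ μ Iᶜ = 0

/-- Ideals of compact sets. -/
structure IsCompactIdeal (I : Set (Compacts ℝ)) : Prop where
  mono : ∀ M₁ M₂ : Compacts ℝ, (M₁ : Set ℝ) ⊆ M₂ → M₂ ∈ I → M₁ ∈ I
  union : ∀ M₁ M₂ : Compacts ℝ, M₁ ∈ I → M₂ ∈ I → M₁ ⊔ M₂ ∈ I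

/-- Invariance under all translations `M ↦ M + t`. -/
def IsShiftInvariant (I : Set (Compacts ℝ)) : Prop :=
  ∀ M ∈ I, ∀ t : ℝ, M.map (fun m : ℝ => m + t) (continuous_add_const t) ∈ I

/-- The set of all finite subsets of `ℝ`. -/
def finiteCompacts : Set (Compacts ℝ) := {M | (M : Set ℝ).Finite}

/-- `G` is a sub-σ-field such that `L₂(G)` consists exactly of the square integrable `f`
whose spectral measure is concentrated on `I`. -/
structure IsSpectralSigmaField {mΩ : MeasurableSpace Ω} (P : Measure Ω)
    (F : ℝ → ℝ → MeasurableSpace Ω) (I : Set (Compacts ℝ)) (G : MeasurableSpace Ω) : Prop where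
  sub : IsSubSigmaField P G
  measurable_iff : ∀ f : Ω → ℝ, MemLp f 2 P →
    (AEStronglyMeasurable[G] f P ↔ SpectrumIn P F f I)

/-- A noise: a continuous factorization with a one-parameter group of automorphisms `α t`
(invertible measure preserving transformations modulo null sets) that shifts the factorization
and is continuous. -/
structure IsNoise {mΩ : MeasurableSpace Ω} (P : Measure Ω) (F : ℝ → ℝ → MeasurableSpace Ω)
    (α : ℝ → Ω → Ω) : Prop where
  fact : IsContinuousFactorization P F
  preserving : ∀ t : ℝ, MeasurePreserving (α t) P P
  zero : α 0 =ᵐ[P] id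
  add : ∀ s t : ℝ, α (s + t) =ᵐ[P] α s ∘ α t
  shift : ∀ r s t : ℝ, r ≤ s →
    nullCompletion P ((F r s).comap (α t)) = F (r - t) (s - t)
  cont : ∀ A : Set Ω, MeasurableSet[mΩ] A →
    Tendsto (fun t : ℝ => P (symmDiff A (α t ⁻¹' A))) (𝓝 0) (𝓝 0)

/-- A classical factorization: every spectral measure is concentrated on the finite sets. -/
def IsClassical {mΩ : MeasurableSpace Ω} (P : Measure Ω) (F : ℝ → ℝ → MeasurableSpace Ω) : Prop :=
  ∀ f : Ω → ℝ, MemLp f 2 P → SpectrumIn P F f finiteCompacts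

end ContFact

set_option linter.unusedSectionVars false

/-! For f in L₂ put m_f(E) = ‖E(f | F_E)‖² (`mass`). Fields over disjoint sets are independent, and
for elementary D one has E(E(f | F_E) | F_D) = E(f | F_{E ∩ D}). The conditional expectations
therefore behave like commuting projections indexed by sets, and m_f plays the role of E ↦ μ_f{M ⊆
E}. Existence of μ_f (`exists_isSpectralMeasure`) comes from discretizing on dyadic cells and
passing to a weak limit; uniqueness holds because the events {M ⊆ E} form a π-system generating the
Borel σ-field of the compacts. By the parallelogram identity μ_{f+g} + μ_{f-g} = 2(μ_f + μ_g), the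
functions with spectrum in I form a closed linear space.

Heredity to the traces E ∩ F_{s,t} rests on `spectrumIn_condExp_indicator`: if f has spectrum in I
and b is an event outside [r, s], then E(1_b f | F_{r,s}) still has spectrum in I. For a sign h = ±1
measurable over D, the map f ↦ h E(hf | F_{Dᶜ}) is an orthogonal projection that commutes with
conditioning on F_{E ∪ D}. Hence the spectral measure of E(hf | F_{Dᶜ}) is dominated by the image of
μ_f under M ↦ M ∩ Dᶜ, and passing to a subset stays in the ideal. For condition (a), take f
measurable over E ∩ F_{r,t} and orthogonal to (E ∩ F_{r,s}) ⊗ (E ∩ F_{s,t}). Its integral over a ∩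
b, with a in F_{r,s} and b in F_{s,t}, is computed through such conditional expectations, which lie
in the traces; so all these integrals vanish and f = 0. Conditions (b) and (c) use the same
orthogonality argument along directed families of intervals.

For noises, composing with α_t translates the spectral measure by -t, so a shift-invariant I gives
an α-invariant σ-field.

For the classical sub-noise, the functions with almost surely finite spectral set form a closed
vector lattice containing the constants, and such a lattice is L₂ of a σ-field. The lattice property
is the delicate point. From |E(f | m)| ≤ E(|f| | m) one gets μ_f{M ⊆ E} ≤ μ_{|f|}{M ⊆ E} for all
elementary E. Random thinning writes p^{|M|}, up to discretization, as a combination of such events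
with nonnegative coefficients; letting p → 1 gives μ_f(finite) ≤ μ_{|f|}(finite), while the total
masses agree. -/

namespace ContFact

/-! ### Conditional expectations in L₂ and independence. -/

section General

variable {Ω : Type*} {mΩ : MeasurableSpace Ω} {P : Measure Ω} [IsProbabilityMeasure P]
  {m A B C : MeasurableSpace Ω} {f g : Ω → ℝ}

theorem integrable_of_memLp_two (hf : MemLp f 2 P) : Integrable f P :=
  hf.integrable one_le_two

theorem memLp_condExp_two (hf : MemLp f 2 P) : MemLp (P[f|m]) 2 P :=
  hf.condExp one_le_two

theorem integrable_mul_of_memLp_two (hf : MemLp f 2 P) (hg : MemLp g 2 P) :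
    Integrable (f * g) P :=
  hf.integrable_mul hg

theorem eLpNorm_two_sq (hf : MemLp f 2 P) :
    eLpNorm f 2 P ^ 2 = ENNReal.ofReal (∫ x, f x ^ 2 ∂P) := by
  rw [hf.eLpNorm_eq_integral_rpow_norm two_ne_zero ENNReal.ofNat_ne_top,
    ← ENNReal.ofReal_pow (by positivity)]
  congr 1
  simp only [ENNReal.toReal_ofNat, Real.rpow_ofNat, Real.norm_eq_abs, sq_abs]
  rw [← one_div, ← Real.sqrt_eq_rpow, Real.sq_sqrt (integral_nonneg fun _ => sq_nonneg _)]

theorem integral_condExp_mul (hm : m ≤ mΩ) (hf : MemLp f 2 P) (hg : MemLp g 2 P) :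
    ∫ x, (P[f|m]) x * g x ∂P = ∫ x, (P[f|m]) x * (P[g|m]) x ∂P := by
  rw [← integral_condExp hm (f := fun x => (P[f|m]) x * g x)]
  refine integral_congr_ae ?_
  exact condExp_mul_of_stronglyMeasurable_left stronglyMeasurable_condExp
    (integrable_mul_of_memLp_two (memLp_condExp_two hf) hg) (integrable_of_memLp_two hg)

theorem integral_mul_condExp (hm : m ≤ mΩ) (hf : MemLp f 2 P) (hg : MemLp g 2 P) :
    ∫ x, f x * (P[g|m]) x ∂P = ∫ x, (P[f|m]) x * (P[g|m]) x ∂P := by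
  simpa only [mul_comm] using integral_condExp_mul hm hg hf

theorem integral_condExp_mul_comm (hm : m ≤ mΩ) (hf : MemLp f 2 P) (hg : MemLp g 2 P) :
    ∫ x, (P[f|m]) x * g x ∂P = ∫ x, f x * (P[g|m]) x ∂P := by
  rw [integral_condExp_mul hm hf hg, integral_mul_condExp hm hf hg]

theorem condExp_ae_of_aestronglyMeasurable (hm : m ≤ mΩ) (hf : AEStronglyMeasurable[m] f P)
    (hi : MemLp f 2 P) : P[f|m] =ᵐ[P] f :=
  condExp_of_aestronglyMeasurable' hm hf (integrable_of_memLp_two hi)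

theorem integral_sq_add (hf : MemLp f 2 P) (hg : MemLp g 2 P) :
    ∫ x, (f x + g x) ^ 2 ∂P = ∫ x, f x ^ 2 ∂P + 2 * ∫ x, f x * g x ∂P + ∫ x, g x ^ 2 ∂P := by
  have h : (fun x => (f x + g x) ^ 2) = fun x => f x ^ 2 + 2 * (f x * g x) + g x ^ 2 := by
    ext x; ring
  have hfg : Integrable (fun x => f x * g x) P := integrable_mul_of_memLp_two hf hg
  have hfg2 : Integrable (fun x => 2 * (f x * g x)) P := hfg.const_mul 2
  have hsum : Integrable (fun x => f x ^ 2 + 2 * (f x * g x)) P := hf.integrable_sq.add hfg2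
  rw [h, integral_add hsum hg.integrable_sq, integral_add hf.integrable_sq hfg2,
    integral_const_mul]

theorem integral_sq_sub (hf : MemLp f 2 P) (hg : MemLp g 2 P) :
    ∫ x, (f x - g x) ^ 2 ∂P = ∫ x, f x ^ 2 ∂P - 2 * ∫ x, f x * g x ∂P + ∫ x, g x ^ 2 ∂P := by
  have h := integral_sq_add hf hg.neg
  simp only [Pi.neg_apply, ← sub_eq_add_neg, mul_neg, neg_sq, integral_neg] at h
  exact h

theorem integral_sq_eq_condExp_add (hm : m ≤ mΩ) (hf : MemLp f 2 P) :
    ∫ x, f x ^ 2 ∂P = ∫ x, (P[f|m]) x ^ 2 ∂P + ∫ x, (f x - (P[f|m]) x) ^ 2 ∂P := by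
  have h := integral_mul_condExp hm hf hf
  rw [integral_sq_sub hf (memLp_condExp_two hf), h]
  simp only [← sq]
  ring

theorem integral_condExp_sq_le (hm : m ≤ mΩ) (hf : MemLp f 2 P) :
    ∫ x, (P[f|m]) x ^ 2 ∂P ≤ ∫ x, f x ^ 2 ∂P := by
  rw [integral_sq_eq_condExp_add hm hf]
  exact le_add_of_nonneg_right (integral_nonneg fun _ => sq_nonneg _)

theorem integral_condExp_sq_mono (hAB : A ≤ B) (hB : B ≤ mΩ) (hf : MemLp f 2 P) :
    ∫ x, (P[f|A]) x ^ 2 ∂P ≤ ∫ x, (P[f|B]) x ^ 2 ∂P := by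
  refine le_trans (le_of_eq ?_) (integral_condExp_sq_le (hAB.trans hB) (memLp_condExp_two hf))
  refine integral_congr_ae ?_
  filter_upwards [condExp_condExp_of_le (f := f) hAB hB (μ := P)] with x hx
  rw [hx]

/-- A function whose integrals over a `π`-system vanish has vanishing integrals over the generated
σ-field. -/
theorem setIntegral_eq_zero_of_isPiSystem {S : Set (Set Ω)} (hS : IsPiSystem S)
    (hm : m = MeasurableSpace.generateFrom S) (hle : m ≤ mΩ) (hg : Integrable g P)
    (huniv : ∫ x, g x ∂P = 0) (h : ∀ s ∈ S, ∫ x in s, g x ∂P = 0) (s : Set Ω)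
    (hs : MeasurableSet[m] s) : ∫ x in s, g x ∂P = 0 := by
  induction s, hs using MeasurableSpace.induction_on_inter hm hS with
  | empty => simp
  | basic t ht => exact h t ht
  | compl t ht ih => rw [setIntegral_compl (hle _ ht) hg, ih, huniv, sub_zero]
  | iUnion f hd hf ih =>
    rw [integral_iUnion (fun i => hle _ (hf i)) hd hg.integrableOn]
    simp [ih]

theorem isPiSystem_image2_inter (A B : MeasurableSpace Ω) :
    IsPiSystem (Set.image2 (· ∩ ·) {s | MeasurableSet[A] s} {s | MeasurableSet[B] s}) := by
  rintro _ ⟨a, ha, b, hb, rfl⟩ _ ⟨a', ha', b', hb', rfl⟩ -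
  refine ⟨a ∩ a', MeasurableSet.inter ha ha', b ∩ b', MeasurableSet.inter hb hb', ?_⟩
  exact Set.inter_inter_inter_comm a a' b b'

theorem sup_eq_generateFrom_image2_inter (A B : MeasurableSpace Ω) :
    A ⊔ B = MeasurableSpace.generateFrom
      (Set.image2 (· ∩ ·) {s | MeasurableSet[A] s} {s | MeasurableSet[B] s}) := by
  apply le_antisymm
  · refine sup_le (fun s hs => ?_) (fun s hs => ?_)
    · exact MeasurableSpace.measurableSet_generateFrom
        ⟨s, hs, Set.univ, MeasurableSet.univ, Set.inter_univ s⟩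
    · exact MeasurableSpace.measurableSet_generateFrom
        ⟨Set.univ, MeasurableSet.univ, s, hs, Set.univ_inter s⟩
  · refine MeasurableSpace.generateFrom_le ?_
    rintro _ ⟨a, ha, b, hb, rfl⟩
    exact MeasurableSet.inter (le_sup_left (a := A) _ ha) (le_sup_right (a := A) _ hb)

theorem setIntegral_of_indep (hB : B ≤ mΩ) (hC : C ≤ mΩ) (hBC : Indep B C P) {b : Set Ω}
    (hb : MeasurableSet[B] b) (hg : StronglyMeasurable[C] g) (hi : Integrable g P) :
    ∫ x in b, g x ∂P = P.real b * ∫ x, g x ∂P := by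
  rw [← setIntegral_condExp hB hi hb,
    setIntegral_congr_ae (g := fun _ => ∫ x, g x ∂P) (hB _ hb)]
  · simp
  · filter_upwards [condExp_indep_eq hC hB hg hBC.symm] with x hx _ using hx

theorem ae_eq_zero_of_forall_setIntegral_eq_zero (hm : m ≤ mΩ) (hf : AEStronglyMeasurable[m] f P)
    (hi : MemLp f 2 P) (h : ∀ s, MeasurableSet[m] s → ∫ x in s, f x ∂P = 0) : f =ᵐ[P] 0 := by
  refine (condExp_ae_of_aestronglyMeasurable hm hf hi).symm.trans (EventuallyEq.symm ?_)
  refine ae_eq_condExp_of_forall_setIntegral_eq hm (integrable_of_memLp_two hi)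
    (fun s _ _ => integrableOn_zero) (fun s hs _ => ?_) aestronglyMeasurable_zero
  rw [h s hs]
  simp

theorem memLp_indicator_one {s : Set Ω} (hs : MeasurableSet[mΩ] s) (p : ENNReal) :
    MemLp (s.indicator fun _ => (1 : ℝ)) p P :=
  memLp_indicator_const p hs 1 (Or.inr (measure_ne_top P s))

theorem integral_indicator_one_mul {s : Set Ω} (hs : MeasurableSet[mΩ] s) (f : Ω → ℝ) :
    ∫ x, s.indicator (fun _ => (1 : ℝ)) x * f x ∂P = ∫ x in s, f x ∂P := by
  rw [← integral_indicator hs]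
  congr 1
  ext x
  by_cases hx : x ∈ s <;> simp [hx]

/-- If `B` is independent of `C ⊇ A`, then conditioning a function of `A ⊔ B` on `C` is the same
as conditioning it on `A`. -/
theorem condExp_eq_of_indep (hAC : A ≤ C) (hB : B ≤ mΩ) (hC : C ≤ mΩ) (hBC : Indep B C P)
    (hf : MemLp f 2 P) (hfm : AEStronglyMeasurable[A ⊔ B] f P) : P[f|C] =ᵐ[P] P[f|A] := by
  have hA := hAC.trans hC
  have hAB : A ⊔ B ≤ mΩ := sup_le hA hB
  refine (ae_eq_condExp_of_forall_setIntegral_eq hC (integrable_of_memLp_two hf)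
    (fun s _ _ => integrable_condExp.integrableOn) (fun c hc _ => ?_)
    (stronglyMeasurable_condExp.mono hAC).aestronglyMeasurable).symm
  have hu : MemLp (c.indicator fun _ => (1 : ℝ)) 2 P := memLp_indicator_one (hC c hc) 2
  set u : Ω → ℝ := c.indicator fun _ => (1 : ℝ) with hu_def
  have huC : StronglyMeasurable[C] u := stronglyMeasurable_const.indicator hc
  have hui := integrable_of_memLp_two hu
  have hgC : StronglyMeasurable[C] (u - P[u|A]) :=
    huC.sub (stronglyMeasurable_condExp.mono hAC)
  have hgi : Integrable (u - P[u|A]) P := hui.sub integrable_condExp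
  have hga : ∀ a, MeasurableSet[A] a → ∫ x in a, (u - P[u|A]) x ∂P = 0 := by
    intro a ha
    simp only [Pi.sub_apply]
    rw [integral_sub hui.integrableOn integrable_condExp.integrableOn,
      setIntegral_condExp hA hui ha, sub_self]
  -- It suffices to test on a ∩ b. There 1_a (u - E(u | A)) is C-measurable, so independence of B
  -- factors out P(b) and leaves an integral over a, which is zero.
  have hzero := setIntegral_eq_zero_of_isPiSystem (isPiSystem_image2_inter A B)
    (sup_eq_generateFrom_image2_inter A B) hAB hgi
    (by simpa using hga Set.univ MeasurableSet.univ) (by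
      rintro _ ⟨a, ha, b, hb, rfl⟩
      have ha' : MeasurableSet[mΩ] a := hA _ ha
      change ∫ x in a ∩ b, _ ∂P = 0
      rw [Set.inter_comm, ← setIntegral_indicator ha', setIntegral_of_indep hB hC hBC hb
        (hgC.indicator (hAC _ ha)) (hgi.indicator ha'), integral_indicator ha', hga a ha,
        mul_zero])
  have key : P[u|A ⊔ B] =ᵐ[P] P[u|A] := by
    refine (ae_eq_condExp_of_forall_setIntegral_eq hAB hui
      (fun s _ _ => integrable_condExp.integrableOn) (fun s hs _ => ?_)
      (stronglyMeasurable_condExp.mono (le_sup_left : A ≤ A ⊔ B)).aestronglyMeasurable).symm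
    have := hzero s hs
    simp only [Pi.sub_apply] at this
    rw [integral_sub hui.integrableOn integrable_condExp.integrableOn] at this
    linarith
  -- Conditional expectation is self-adjoint, so E(u | A ⊔ B) = E(u | A) for all indicators u over C
  -- is dual to the claim for f.
  rw [← integral_indicator_one_mul (hC c hc), ← integral_indicator_one_mul (hC c hc), ← hu_def,
    ← integral_condExp_mul_comm hA hu hf]
  calc ∫ x, (P[u|A]) x * f x ∂P = ∫ x, (P[u|A ⊔ B]) x * f x ∂P := by
        refine integral_congr_ae ?_
        filter_upwards [key] with x hx
        rw [hx]
    _ = ∫ x, u x * (P[f|A ⊔ B]) x ∂P := integral_condExp_mul_comm hAB hu hf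
    _ = ∫ x, u x * f x ∂P := by
        refine integral_congr_ae ?_
        filter_upwards [condExp_ae_of_aestronglyMeasurable hAB hfm hf] with x hx
        rw [hx]

end General


/-! ### Fields over subsets of the line: triviality at points, splitting, independence, inner
approximation. -/

section Structure

variable {Ω : Type*} {mΩ : MeasurableSpace Ω} {P : Measure Ω} {F : ℝ → ℝ → MeasurableSpace Ω}

theorem sigmaField_le_iff {E : Set ℝ} {m : MeasurableSpace Ω} :
    sigmaField F E ≤ m ↔ ∀ s t : ℝ, s ≤ t → Set.Ioo s t ⊆ E → F s t ≤ m := by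
  simp only [sigmaField, iSup_le_iff, and_imp]

theorem le_sigmaField {E : Set ℝ} {s t : ℝ} (hst : s ≤ t) (h : Set.Ioo s t ⊆ E) :
    F s t ≤ sigmaField F E :=
  sigmaField_le_iff.1 le_rfl s t hst h

theorem sigmaField_mono {E E' : Set ℝ} (h : E ⊆ E') : sigmaField F E ≤ sigmaField F E' :=
  sigmaField_le_iff.2 fun _ _ hst hE => le_sigmaField hst (hE.trans h)

theorem IsSubSigmaField.of_le {m m' : MeasurableSpace Ω} (h : IsSubSigmaField P m) (hle : m ≤ m')
    (hm' : m' ≤ mΩ) : IsSubSigmaField P m' :=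
  ⟨hm', fun N hN h0 => hle _ (h.null N hN h0)⟩

namespace IsContinuousFactorization

variable (hF : IsContinuousFactorization P F)
include hF

theorem le_space {s t : ℝ} (hst : s ≤ t) : F s t ≤ mΩ := (hF.sub s t hst).le

theorem mono {r s t u : ℝ} (hrs : r ≤ s) (hst : s ≤ t) (htu : t ≤ u) : F s t ≤ F r u := by
  have h1 : F s t ≤ F r t := by
    rw [← hF.sup r s t hrs hst]; exact le_sup_right
  have h2 : F r t ≤ F r u := by
    rw [← hF.sup r t u (hrs.trans hst) htu]; exact le_sup_left
  exact h1.trans h2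

/-- Taking r = s = t in the independence axiom makes `F a a` independent of itself. -/
theorem measure_eq_zero_or_one {a : ℝ} {A : Set Ω} (hA : MeasurableSet[F a a] A) :
    P A = 0 ∨ P A = 1 := by
  have := hF.prob
  have h := (Indep_iff _ _ _).1 (hF.indep a a a le_rfl le_rfl) A A hA hA
  rw [Set.inter_self] at h
  by_cases h0 : P A = 0
  · exact Or.inl h0
  · right
    have h1 : P A * 1 = P A * P A := by rw [mul_one]; exact h
    exact ((ENNReal.mul_right_inj h0 (measure_ne_top P A)).1 h1).symm

/-- The field at a point is trivial modulo null sets, and every sub-σ-field contains the null sets.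
This settles the degenerate intervals s = t everywhere below. -/
theorem self_le {m : MeasurableSpace Ω} (hm : IsSubSigmaField P m) (a : ℝ) : F a a ≤ m := by
  intro A hA
  have := hF.prob
  have hA' := hF.le_space le_rfl A hA
  rcases hF.measure_eq_zero_or_one hA with h | h
  · exact hm.null A hA' h
  · refine MeasurableSet.of_compl (hm.null Aᶜ hA'.compl ?_)
    rwa [prob_compl_eq_zero_iff hA']

theorem sigmaField_le (E : Set ℝ) : sigmaField F E ≤ mΩ :=
  sigmaField_le_iff.2 fun _ _ hst _ => hF.le_space hst

theorem isSubSigmaField (E : Set ℝ) : IsSubSigmaField P (sigmaField F E) :=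
  (hF.sub 0 0 le_rfl).of_le (le_sigmaField le_rfl (by simp)) (hF.sigmaField_le E)

theorem sigmaField_Icc {r s : ℝ} (hrs : r ≤ s) : sigmaField F (Set.Icc r s) = F r s := by
  apply le_antisymm
  · refine sigmaField_le_iff.2 fun a b hab h => ?_
    rcases hab.eq_or_lt with rfl | hlt
    · exact hF.self_le (hF.sub r s hrs) a
    · have h' : Set.Icc a b ⊆ Set.Icc r s := by
        rw [← closure_Ioo hlt.ne]
        exact closure_minimal h isClosed_Icc
      rw [Set.Icc_subset_Icc_iff hab] at h'
      exact hF.mono h'.1 hab h'.2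
  · exact le_sigmaField hrs Set.Ioo_subset_Icc_self

theorem sigmaField_univ : sigmaField F Set.univ = mΩ := by
  apply le_antisymm (hF.sigmaField_le _)
  conv_lhs => rw [← hF.exhaust]
  refine iSup₂_le fun n hn => le_sigmaField ?_ (Set.subset_univ _)
  have : (0 : ℝ) ≤ n := Nat.cast_nonneg n
  linarith

end IsContinuousFactorization

/-- Sets along which every interval field splits. -/
def IsSplitting (F : ℝ → ℝ → MeasurableSpace Ω) (D : Set ℝ) : Prop :=
  ∀ E : Set ℝ, sigmaField F E ≤ sigmaField F (E ∩ D) ⊔ sigmaField F (E \ D)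

theorem IsSplitting.compl {D : Set ℝ} (h : IsSplitting F D) : IsSplitting F Dᶜ := by
  intro E
  rw [← Set.sdiff_eq, Set.sdiff_compl, sup_comm]
  exact h E

theorem IsSplitting.union {D D' : Set ℝ} (h : IsSplitting F D) (h' : IsSplitting F D') :
    IsSplitting F (D ∪ D') := by
  intro E
  refine (h E).trans (sup_le ?_ ((h' _).trans (sup_le ?_ ?_)))
  · exact (sigmaField_mono (by grind)).trans le_sup_left
  · exact (sigmaField_mono (by grind)).trans le_sup_left
  · exact (sigmaField_mono (by grind)).trans le_sup_right

theorem isSplitting_empty : IsSplitting F ∅ := fun E => by simp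

theorem IsSplitting.biUnion {ι : Type*} (s : Finset ι) {D : ι → Set ℝ}
    (h : ∀ i ∈ s, IsSplitting F (D i)) : IsSplitting F (⋃ i ∈ s, D i) := by
  classical
  induction s using Finset.induction_on with
  | empty => simpa using isSplitting_empty
  | insert a s ha ih =>
    rw [Finset.set_biUnion_insert]
    exact (h a (Finset.mem_insert_self a s)).union
      (ih fun i hi => h i (Finset.mem_insert_of_mem hi))

namespace IsContinuousFactorization

variable (hF : IsContinuousFactorization P F)
include hF

/-- Cut (s, t) at the infimum and the supremum of (s, t) ∩ J: the middle piece lies in J and the two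
outer ones avoid J. Endpoints cost nothing, since `F` is additive at every cut point. -/
theorem isSplitting_of_ordConnected {J : Set ℝ} (hJ : J.OrdConnected) : IsSplitting F J := by
  intro E
  refine sigmaField_le_iff.2 fun s t hst hE => ?_
  by_cases hne : (Set.Ioo s t ∩ J).Nonempty
  · set K := Set.Ioo s t ∩ J with hK
    have hKbb : BddBelow K := ⟨s, fun x hx => hx.1.1.le⟩
    have hKba : BddAbove K := ⟨t, fun x hx => hx.1.2.le⟩
    have hKo : K.OrdConnected := Set.ordConnected_Ioo.inter hJ
    have hsa : s ≤ sInf K := le_csInf hne fun x hx => hx.1.1.le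
    have hbt : sSup K ≤ t := csSup_le hne fun x hx => hx.1.2.le
    have hab : sInf K ≤ sSup K := csInf_le_csSup hne hKbb hKba
    have hsub : Set.Ioo (sInf K) (sSup K) ⊆ K := by
      intro x hx
      obtain ⟨y, hy, hyx⟩ := exists_lt_of_csInf_lt hne hx.1
      obtain ⟨z, hz, hxz⟩ := exists_lt_of_lt_csSup hne hx.2
      exact hKo.out hy hz ⟨hyx.le, hxz.le⟩
    rw [← hF.sup s _ t hsa (hab.trans hbt), ← hF.sup _ _ t hab hbt]
    refine sup_le ?_ (sup_le ?_ ?_)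
    · refine (le_sigmaField hsa ?_).trans le_sup_right
      intro x hx
      have hxI : x ∈ Set.Ioo s t := ⟨hx.1, hx.2.trans_le (hab.trans hbt)⟩
      exact ⟨hE hxI, fun hxJ => (csInf_le hKbb (show x ∈ K from ⟨hxI, hxJ⟩)).not_gt hx.2⟩
    · exact le_trans (le_sigmaField (E := E ∩ J) hab fun x hx => ⟨hE (hsub hx).1, (hsub hx).2⟩) le_sup_left
    · refine (le_sigmaField hbt ?_).trans le_sup_right
      intro x hx
      have hxI : x ∈ Set.Ioo s t := ⟨(hsa.trans hab).trans_lt hx.1, hx.2⟩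
      exact ⟨hE hxI, fun hxJ => (le_csSup hKba (show x ∈ K from ⟨hxI, hxJ⟩)).not_gt hx.1⟩
  · exact le_trans (le_sigmaField (E := E \ J) hst fun x hx => ⟨hE hx, fun hxJ => hne ⟨x, hx, hxJ⟩⟩)
      le_sup_right

theorem isSplitting_of_isElementary {E : Set ℝ} (hE : IsElementary E) : IsSplitting F E := by
  obtain ⟨S, hS, hJ, rfl⟩ := hE
  rw [Set.sUnion_eq_biUnion]
  have := IsSplitting.biUnion (F := F) hS.toFinset (D := fun J => J)
    (fun J hJS => hF.isSplitting_of_ordConnected (hJ J (hS.mem_toFinset.1 hJS)))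
  simpa using this

/-- Induction on the largest index: all earlier increments live in a single interval field ending
where the last one starts. -/
theorem iIndep_of_monotone {x : ℤ → ℝ} (hx : Monotone x) :
    iIndep (fun k : ℤ => F (x k) (x (k + 1))) P := by
  have := hF.prob
  rw [iIndep_iff]
  intro s
  induction s using Finset.induction_on_max with
  | empty => simp
  | insert a s hs ih =>
    intro f hf
    have ha : a ∉ s := fun h => lt_irrefl _ (hs a h)
    rw [Finset.set_biInter_insert, Finset.prod_insert ha, Set.inter_comm,
      ← ih fun i hi => hf i (Finset.mem_insert_of_mem hi), mul_comm]
    obtain ⟨c, hc⟩ : ∃ c : ℤ, c ≤ a ∧ ∀ i ∈ s, c ≤ i := by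
      obtain ⟨c, hc⟩ := (insert a s).bddBelow
      exact ⟨c, hc (by simp), fun i hi => hc (by simp [hi])⟩
    refine (Indep_iff _ _ _).1
      (hF.indep (x c) (x a) (x (a + 1)) (hx hc.1) (hx (by lia))) _ _ ?_
      (hf a (Finset.mem_insert_self a s))
    refine Finset.measurableSet_biInter s fun i hi => ?_
    refine hF.mono (hx (hc.2 i hi)) (hx (by lia)) (hx ?_) _ (hf i (Finset.mem_insert_of_mem hi))
    exact hs i hi

/-- The adjoined field has only events of probability 0 or 1. It serves to insert all null sets into
fields generated by cells. -/
theorem indep_sup_self {A B : MeasurableSpace Ω} (hA : A ≤ mΩ) (hB : B ≤ mΩ) (h : Indep A B P)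
    (a : ℝ) : Indep (F a a ⊔ A) B P := by
  have := hF.prob
  refine IndepSets.indep (sup_le (hF.le_space le_rfl) hA) hB (isPiSystem_image2_inter (F a a) A)
    (@MeasurableSpace.isPiSystem_measurableSet Ω B) (sup_eq_generateFrom_image2_inter _ _)
    (@MeasurableSpace.generateFrom_measurableSet Ω B).symm ?_
  rw [IndepSets_iff]
  rintro _ t ⟨u, hu, v, hv, rfl⟩ ht
  have hu' := hF.le_space le_rfl u hu
  have hvt := (Indep_iff _ _ _).1 h v t hv ht
  change P (u ∩ v ∩ t) = P (u ∩ v) * P t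
  rcases hF.measure_eq_zero_or_one hu with h0 | h1
  · rw [measure_mono_null (Set.inter_subset_left.trans Set.inter_subset_left) h0,
      measure_mono_null Set.inter_subset_left h0, zero_mul]
  · have hc : P uᶜ = 0 := by rwa [prob_compl_eq_zero_iff hu']
    have key : ∀ w : Set Ω, P (u ∩ w) = P w := fun w => by
      rw [Set.inter_comm]; exact measure_inter_conull hc
    rw [Set.inter_assoc, key, key, hvt]

end IsContinuousFactorization

/-- The `k`-th dyadic point of level `n`. -/
noncomputable def dyadic (n : ℕ) (k : ℤ) : ℝ := k / 2 ^ n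

theorem dyadic_mono (n : ℕ) : Monotone (dyadic n) := by
  intro a b hab
  unfold dyadic
  gcongr

theorem dyadic_lt {n : ℕ} {a b : ℤ} (hab : a < b) : dyadic n a < dyadic n b := by
  unfold dyadic
  gcongr

theorem dyadic_succ (n : ℕ) (k : ℤ) : dyadic (n + 1) (2 * k) = dyadic n k := by
  unfold dyadic
  rw [pow_succ]
  push_cast
  field_simp

theorem dyadic_add_one (n : ℕ) (k : ℤ) : dyadic n (k + 1) = dyadic n k + 1 / 2 ^ n := by
  unfold dyadic
  push_cast
  ring

/-- The part of `sigmaField F E` carried by the dyadic cells of level `n` inside `E`. -/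
@[reducible] noncomputable def gridField (F : ℝ → ℝ → MeasurableSpace Ω) (n : ℕ) (E : Set ℝ) :
    MeasurableSpace Ω :=
  F 0 0 ⊔ ⨆ k ∈ {k : ℤ | Set.Ioo (dyadic n k) (dyadic n (k + 1)) ⊆ E},
    F (dyadic n k) (dyadic n (k + 1))

namespace IsContinuousFactorization

variable (hF : IsContinuousFactorization P F)
include hF

theorem gridField_cells_le (n : ℕ) (S : Set ℤ) :
    ⨆ k ∈ S, F (dyadic n k) (dyadic n (k + 1)) ≤ mΩ :=
  iSup₂_le fun k _ => hF.le_space (dyadic_mono n (by lia))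

theorem gridField_le (n : ℕ) (E : Set ℝ) : gridField F n E ≤ mΩ :=
  sup_le (hF.le_space le_rfl) (hF.gridField_cells_le n _)

theorem le_gridField {n : ℕ} {a b : ℤ} (hab : a ≤ b) {E : Set ℝ}
    (h : Set.Ioo (dyadic n a) (dyadic n b) ⊆ E) :
    F (dyadic n a) (dyadic n b) ≤ gridField F n E := by
  induction b, hab using Int.leInduction with
  | base =>
    exact hF.self_le ((hF.sub 0 0 le_rfl).of_le le_sup_left (hF.gridField_le n E)) _
  | succ b hab ih =>
    rw [← hF.sup _ (dyadic n b) _ (dyadic_mono n hab) (dyadic_mono n (by lia))]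
    refine sup_le (ih ?_) ?_
    · exact (Set.Ioo_subset_Ioo_right (dyadic_mono n (by lia))).trans h
    · refine le_trans ?_ le_sup_right
      exact le_iSup₂ (f := fun k (_ : k ∈ {k : ℤ | Set.Ioo (dyadic n k) (dyadic n (k + 1)) ⊆ E}) =>
        F (dyadic n k) (dyadic n (k + 1))) b
        ((Set.Ioo_subset_Ioo_left (dyadic_mono n hab)).trans h)

theorem gridField_mono (E : Set ℝ) : Monotone fun n => gridField F n E := by
  refine monotone_nat_of_le_succ fun n => sup_le le_sup_left (iSup₂_le fun k hk => ?_)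
  rw [← dyadic_succ n k, ← dyadic_succ n (k + 1)]
  refine hF.le_gridField (show 2 * k ≤ 2 * (k + 1) by lia) ?_
  rw [dyadic_succ, dyadic_succ]
  exact hk

theorem indep_gridField (n : ℕ) {E E' : Set ℝ} (h : Disjoint E E') :
    Indep (gridField F n E) (gridField F n E') P := by
  refine hF.indep_sup_self (hF.gridField_cells_le n _) (hF.gridField_le n E') ?_ 0
  refine (hF.indep_sup_self (hF.gridField_cells_le n _) (hF.gridField_cells_le n _) ?_ 0).symm
  refine indep_iSup_of_disjoint (fun k => hF.le_space (dyadic_mono n (by lia)))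
    (hF.iIndep_of_monotone (dyadic_mono n)) ?_
  rw [Set.disjoint_left]
  intro k hk hk'
  obtain ⟨x, hx⟩ := Set.nonempty_Ioo.2 (dyadic_lt (n := n) (show k < k + 1 by lia))
  exact Set.disjoint_left.1 h (hk' hx) (hk hx)

/-- By the inner continuity axiom it is enough to catch F over (s + ε, t - ε), and once 2⁻ⁿ < ε a
dyadic interval fits between (s + ε, t - ε) and (s, t). -/
theorem sigmaField_le_iSup_gridField (E : Set ℝ) :
    sigmaField F E ≤ ⨆ n, gridField F n E := by
  have hsub : IsSubSigmaField P (⨆ n, gridField F n E) :=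
    (hF.sub 0 0 le_rfl).of_le (le_iSup_of_le 0 le_sup_left) (iSup_le fun n => hF.gridField_le n E)
  refine sigmaField_le_iff.2 fun s t hst hE => ?_
  rcases hst.eq_or_lt with rfl | hlt
  · exact hF.self_le hsub s
  rw [← hF.inner s t hlt]
  refine iSup₂_le fun ε hε => ?_
  obtain ⟨n, hn⟩ := exists_pow_lt_of_lt_one hε.1 (show (1 / 2 : ℝ) < 1 by norm_num)
  have h2 : (0 : ℝ) < 2 ^ n := by positivity
  rw [one_div_pow] at hn
  have ha1 : dyadic n ⌊(s + ε) * 2 ^ n⌋ ≤ s + ε := by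
    rw [dyadic, div_le_iff₀ h2]; exact Int.floor_le _
  have ha2 : s ≤ dyadic n ⌊(s + ε) * 2 ^ n⌋ := by
    rw [dyadic, le_div_iff₀ h2]
    have := Int.sub_one_lt_floor ((s + ε) * 2 ^ n)
    rw [div_lt_iff₀ h2] at hn
    linarith
  have hb1 : t - ε ≤ dyadic n ⌈(t - ε) * 2 ^ n⌉ := by
    rw [dyadic, le_div_iff₀ h2]; exact Int.le_ceil _
  have hb2 : dyadic n ⌈(t - ε) * 2 ^ n⌉ ≤ t := by
    rw [dyadic, div_le_iff₀ h2]
    have := Int.ceil_lt_add_one ((t - ε) * 2 ^ n)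
    rw [div_lt_iff₀ h2] at hn
    linarith
  refine (hF.mono ha1 hε.2 hb1).trans (le_iSup_of_le n (hF.le_gridField ?_ ?_))
  · rw [← @Int.cast_le ℝ]
    refine (Int.floor_le _).trans (le_trans ?_ (Int.le_ceil _))
    gcongr
    exact hε.2
  · exact (Set.Ioo_subset_Ioo ha2 hb2).trans hE

/-- At a common dyadic level the cells inside E and inside E' are distinct, hence independent;
monotone limits in both levels do the rest. No regularity of the two sets is needed. -/
theorem indep_sigmaField {E E' : Set ℝ} (h : Disjoint E E') :
    Indep (sigmaField F E) (sigmaField F E') P := by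
  have := hF.prob
  refine indep_of_indep_of_le (m₁ := ⨆ n, gridField F n E) (m₂ := ⨆ n, gridField F n E') ?_
    (hF.sigmaField_le_iSup_gridField E) (hF.sigmaField_le_iSup_gridField E')
  refine indep_iSup_of_monotone (fun n => ?_) (hF.gridField_le · E)
    (iSup_le (hF.gridField_le · E')) (hF.gridField_mono E)
  refine (indep_iSup_of_monotone (fun k => ?_) (hF.gridField_le · E')
    (hF.gridField_le n E) (hF.gridField_mono E')).symm
  exact (indep_of_indep_of_le (hF.indep_gridField (max n k) h)
    (hF.gridField_mono E (le_max_left n k)) (hF.gridField_mono E' (le_max_right n k))).symm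

end IsContinuousFactorization

/-- The points at depth `1 / (n + 1)` in `E`, within the window `[-n, n]`. -/
def erosion (n : ℕ) (E : Set ℝ) : Set ℝ :=
  {x | |x| ≤ n ∧ Set.Icc (x - 1 / (n + 1)) (x + 1 / (n + 1)) ⊆ E}

theorem erosion_subset (n : ℕ) (E : Set ℝ) : erosion n E ⊆ E := fun x hx => by
  refine hx.2 ⟨?_, ?_⟩ <;> simp <;> positivity

theorem erosion_mono (E : Set ℝ) : Monotone fun n => erosion n E := by
  intro n k hnk x hx
  refine ⟨hx.1.trans (by exact_mod_cast hnk), (Set.Icc_subset_Icc ?_ ?_).trans hx.2⟩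
  · gcongr
  · gcongr

theorem IsContinuousFactorization.iSup_erosion (hF : IsContinuousFactorization P F) (E : Set ℝ) :
    ⨆ n, sigmaField F (erosion n E) = sigmaField F E := by
  apply le_antisymm (iSup_le fun n => sigmaField_mono (erosion_subset n E))
  have hsub : IsSubSigmaField P (⨆ n, sigmaField F (erosion n E)) :=
    (hF.isSubSigmaField _).of_le (le_iSup (fun n => sigmaField F (erosion n E)) 0)
      (iSup_le fun n => hF.sigmaField_le _)
  refine sigmaField_le_iff.2 fun s t hst hE => ?_
  rcases hst.eq_or_lt with rfl | hlt
  · exact hF.self_le hsub s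
  rw [← hF.inner s t hlt]
  refine iSup₂_le fun ε hε => ?_
  obtain ⟨n, hn⟩ := exists_nat_gt (max (1 / ε) (max |s| |t|))
  simp only [max_lt_iff] at hn
  refine le_trans (le_sigmaField hε.2 ?_) (le_iSup (fun n => sigmaField F (erosion n E)) n)
  refine fun x hx => ⟨?_, fun y hy => hE ?_⟩
  · have h1 := abs_lt.1 hn.2.1
    have h2 := abs_lt.1 hn.2.2
    have h3 := hε.1
    rw [abs_le]
    constructor <;> linarith [hx.1, hx.2]
  · have h1 : (1 : ℝ) / (n + 1) < ε := by
      rw [div_lt_iff₀ (by positivity)]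
      have := hn.1
      rw [div_lt_iff₀ hε.1] at this
      nlinarith [hε.1]
    constructor <;> linarith [hx.1, hx.2, hy.1, hy.2]

end Structure


/-! ### Squared norms of conditional expectations as a set function. -/

section Mass

variable {Ω : Type*} {mΩ : MeasurableSpace Ω} {P : Measure Ω} {F : ℝ → ℝ → MeasurableSpace Ω}
  {f g : Ω → ℝ} {D D' E : Set ℝ}

/-- Lower semicontinuity of the squared norm along an increasing sequence of σ-fields. -/
theorem integral_condExp_iSup_sq_le [IsProbabilityMeasure P] {m : ℕ → MeasurableSpace Ω}
    (hm : Monotone m) (hle : ∀ n, m n ≤ mΩ) (hf : MemLp f 2 P) {c : ℝ}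
    (h : ∀ n, ∫ x, (P[f|m n]) x ^ 2 ∂P ≤ c) : ∫ x, (P[f|⨆ n, m n]) x ^ 2 ∂P ≤ c := by
  have hc : 0 ≤ c := (integral_nonneg fun _ => sq_nonneg _).trans (h 0)
  let ℱ : Filtration ℕ mΩ := ⟨m, hm, hle⟩
  -- Lévy's upward theorem gives almost sure convergence, and Fatou's lemma bounds the norm of the
  -- limit.
  have h1 : eLpNorm (P[f|⨆ n, m n]) 2 P ≤ ENNReal.ofReal (Real.sqrt c) := by
    refine (Lp.eLpNorm_lim_le_liminf_eLpNorm (f := fun n => P[f|m n])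
      (fun n => (memLp_condExp_two hf).1) _ (tendsto_ae_condExp (ℱ := ℱ) f)).trans ?_
    refine liminf_le_of_le (by isBoundedDefault) fun b hb => ?_
    obtain ⟨n, hn⟩ := hb.exists
    refine hn.trans ?_
    rw [← ENNReal.pow_le_pow_left_iff two_ne_zero, eLpNorm_two_sq (memLp_condExp_two hf),
      ← ENNReal.ofReal_pow (Real.sqrt_nonneg c), Real.sq_sqrt hc]
    exact ENNReal.ofReal_le_ofReal (h n)
  rw [← ENNReal.pow_le_pow_left_iff two_ne_zero, eLpNorm_two_sq (memLp_condExp_two hf),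
    ← ENNReal.ofReal_pow (Real.sqrt_nonneg c), Real.sq_sqrt hc, ENNReal.ofReal_le_ofReal_iff hc]
    at h1
  exact h1

/-- The squared norm of the conditional expectation of `f` given `sigmaField F E`. -/
noncomputable def mass (P : Measure Ω) (F : ℝ → ℝ → MeasurableSpace Ω) (f : Ω → ℝ) (E : Set ℝ) :
    ℝ :=
  ∫ x, (P[f|sigmaField F E]) x ^ 2 ∂P

theorem mass_nonneg (f : Ω → ℝ) (E : Set ℝ) : 0 ≤ mass P F f E :=
  integral_nonneg fun _ => sq_nonneg _

theorem isSpectralMeasure_iff [IsProbabilityMeasure P] (hf : MemLp f 2 P)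
    {μ : Measure (Compacts ℝ)} : IsSpectralMeasure P F f μ ↔ ∀ E : Set ℝ, IsElementary E →
      μ {M : Compacts ℝ | (M : Set ℝ) ⊆ E} = ENNReal.ofReal (mass P F f E) := by
  simp only [IsSpectralMeasure, eLpNorm_two_sq (memLp_condExp_two hf), mass]

theorem mass_congr (h : f =ᵐ[P] g) (E : Set ℝ) : mass P F f E = mass P F g E := by
  refine integral_congr_ae ?_
  filter_upwards [condExp_congr_ae (m := sigmaField F E) h] with x hx
  rw [hx]

namespace IsContinuousFactorization

variable (hF : IsContinuousFactorization P F)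
include hF

theorem mass_univ (hf : MemLp f 2 P) : mass P F f Set.univ = ∫ x, f x ^ 2 ∂P := by
  have := hF.prob
  refine integral_congr_ae ?_
  filter_upwards [condExp_ae_of_aestronglyMeasurable (hF.sigmaField_le Set.univ)
    (by rw [hF.sigmaField_univ]; exact hf.1) hf] with x hx
  rw [hx]

theorem mass_mono (hf : MemLp f 2 P) (h : D ⊆ E) : mass P F f D ≤ mass P F f E := by
  have := hF.prob
  exact integral_condExp_sq_mono (sigmaField_mono h) (hF.sigmaField_le E) hf

theorem condExp_of_sigmaField (hD : IsSplitting F D) (E : Set ℝ) (hf : MemLp f 2 P)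
    (hfm : AEStronglyMeasurable[sigmaField F E] f P) :
    P[f|sigmaField F D] =ᵐ[P] P[f|sigmaField F (E ∩ D)] := by
  have := hF.prob
  refine condExp_eq_of_indep (B := sigmaField F (E \ D)) (sigmaField_mono Set.inter_subset_right)
    (hF.sigmaField_le _) (hF.sigmaField_le _) (hF.indep_sigmaField Set.disjoint_sdiff_left) hf
    (hfm.mono (hD E))

/-- The commutation relation behind everything else: conditioning on E and then on D is conditioning
on E ∩ D, because the part of F_E carried by E \ D is independent of F_D. -/
theorem condExp_condExp (hD : IsSplitting F D) (E : Set ℝ) (hf : MemLp f 2 P) :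
    P[P[f|sigmaField F E]|sigmaField F D] =ᵐ[P] P[f|sigmaField F (E ∩ D)] := by
  have := hF.prob
  exact (hF.condExp_of_sigmaField hD E (memLp_condExp_two hf)
    stronglyMeasurable_condExp.aestronglyMeasurable).trans
    (condExp_condExp_of_le (sigmaField_mono Set.inter_subset_left) (hF.sigmaField_le _))

theorem mass_condExp (hD : IsSplitting F D) (E : Set ℝ) (hf : MemLp f 2 P) :
    mass P F (P[f|sigmaField F E]) D = mass P F f (E ∩ D) := by
  refine integral_congr_ae ?_
  filter_upwards [hF.condExp_condExp hD E hf] with x hx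
  rw [hx]

/-- Pythagoras for E(f | F_D), split along F_{D'}. On the spectral side, f - E(f | F_{D'}) carries
exactly the sets that are not contained in D'. -/
theorem mass_sub_condExp (hD : IsSplitting F D) (hD' : IsSplitting F D') (hf : MemLp f 2 P) :
    mass P F (f - P[f|sigmaField F D']) D = mass P F f D - mass P F f (D ∩ D') := by
  have := hF.prob
  have h := integral_sq_eq_condExp_add (hF.sigmaField_le D')
    (memLp_condExp_two (m := sigmaField F D) hf)
  have h1 : mass P F f (D ∩ D') = ∫ x, (P[P[f|sigmaField F D]|sigmaField F D']) x ^ 2 ∂P := by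
    refine integral_congr_ae ?_
    filter_upwards [hF.condExp_condExp hD' D hf] with x hx
    rw [hx]
  have h2 : mass P F (f - P[f|sigmaField F D']) D = ∫ x, ((P[f|sigmaField F D]) x -
      (P[P[f|sigmaField F D]|sigmaField F D']) x) ^ 2 ∂P := by
    refine integral_congr_ae ?_
    filter_upwards [hF.condExp_condExp hD' D hf, hF.condExp_condExp hD D' hf,
      condExp_sub (integrable_of_memLp_two hf) (integrable_condExp (f := f) (m := sigmaField F D'))
        (sigmaField F D)] with x h1 h2 h3
    rw [h3, Pi.sub_apply, h1, h2, Set.inter_comm]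
  rw [h1, h2]
  unfold mass
  linarith

/-- Lower continuity of the spectral masses. -/
theorem mass_le_of_erosion (hf : MemLp f 2 P) (E : Set ℝ) {c : ℝ}
    (h : ∀ n, mass P F f (erosion n E) ≤ c) : mass P F f E ≤ c := by
  have := hF.prob
  have h1 := integral_condExp_iSup_sq_le (m := fun n => sigmaField F (erosion n E))
    (fun _ _ hnk => sigmaField_mono (erosion_mono E hnk)) (fun n => hF.sigmaField_le _) hf h
  rwa [hF.iSup_erosion E] at h1

/-- Upper continuity of the spectral masses. -/
theorem le_mass_of_erosion (hf : MemLp f 2 P) (hE : IsSplitting F E) {c : ℝ}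
    (h : ∀ n, c ≤ mass P F f (erosion n Eᶜ)ᶜ) : c ≤ mass P F f E := by
  have := hF.prob
  set m : ℕ → MeasurableSpace Ω := fun n => sigmaField F E ⊔ sigmaField F (erosion n Eᶜ) with hm
  have hmle : ∀ n, m n ≤ mΩ := fun n => sup_le (hF.sigmaField_le _) (hF.sigmaField_le _)
  have hmono : Monotone m := fun _ _ hnk =>
    sup_le_sup le_rfl (sigmaField_mono (erosion_mono Eᶜ hnk))
  have hsup : ⨆ n, m n = mΩ := by
    apply le_antisymm (iSup_le hmle)
    rw [hm, ← sup_iSup, hF.iSup_erosion Eᶜ]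
    have h1 := hE Set.univ
    rwa [hF.sigmaField_univ, Set.univ_inter, ← Set.compl_eq_univ_sdiff] at h1
  -- With C the field of the n-th outer set, E(f - E(f | m n) | C) = E(f | C) - E(f | F_E). Hence
  -- m_f(outer set) - m_f(E) is at most ‖f‖² - ‖E(f | m n)‖², whose limit is controlled because the
  -- fields `m n` increase to the whole σ-field.
  have key : ∀ n, ∫ x, (P[f|m n]) x ^ 2 ∂P ≤ ∫ x, f x ^ 2 ∂P - c + mass P F f E := by
    intro n
    set C := sigmaField F (erosion n Eᶜ)ᶜ with hC
    have hCle : C ≤ mΩ := hF.sigmaField_le _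
    have hEC : sigmaField F E ≤ C := sigmaField_mono
      (Set.subset_compl_comm.1 (erosion_subset n Eᶜ))
    have hg : P[P[f|m n]|C] =ᵐ[P] P[f|sigmaField F E] :=
      (condExp_eq_of_indep hEC (hF.sigmaField_le (erosion n Eᶜ)) hCle
        (hF.indep_sigmaField disjoint_compl_right) (memLp_condExp_two hf)
        stronglyMeasurable_condExp.aestronglyMeasurable).trans
        (condExp_condExp_of_le le_sup_left (hmle n))
    have hsub : P[f - P[f|m n]|C] =ᵐ[P] P[f|C] - P[f|sigmaField F E] :=
      (condExp_sub (integrable_of_memLp_two hf) integrable_condExp C).trans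
        (EventuallyEq.rfl.sub hg)
    have h1 := integral_condExp_sq_le hCle (hf.sub (memLp_condExp_two (m := m n) hf))
    have h2 := integral_sq_eq_condExp_add (hmle n) hf
    have h3 := integral_sq_eq_condExp_add (hF.sigmaField_le E) (memLp_condExp_two (m := C) hf)
    have h4 : ∫ x, (P[P[f|C]|sigmaField F E]) x ^ 2 ∂P = mass P F f E := by
      refine integral_congr_ae ?_
      filter_upwards [condExp_condExp_of_le (f := f) (μ := P) hEC hCle] with x hx
      rw [hx]
    have h5 : ∫ x, (P[f - P[f|m n]|C]) x ^ 2 ∂P =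
        ∫ x, ((P[f|C]) x - (P[P[f|C]|sigmaField F E]) x) ^ 2 ∂P := by
      refine integral_congr_ae ?_
      filter_upwards [condExp_condExp_of_le (f := f) (μ := P) hEC hCle, hsub] with x hx hx'
      rw [hx, hx', Pi.sub_apply]
    have h6 : c ≤ ∫ x, (P[f|C]) x ^ 2 ∂P := h n
    simp only [Pi.sub_apply] at h1
    linarith
  have h1 := integral_condExp_iSup_sq_le hmono hmle hf key
  rw [hsup] at h1
  have h2 : ∫ x, (P[f|mΩ]) x ^ 2 ∂P = ∫ x, f x ^ 2 ∂P := by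
    refine integral_congr_ae ?_
    filter_upwards [condExp_ae_of_aestronglyMeasurable le_rfl hf.1 hf] with x hx
    rw [hx]
  linarith

/-- The law of the set of the marks `c k` of those cells `J k`, `k ∈ W`, that are hit by the
spectral set of `f`. -/
theorem exists_discrete_spectral_measure (c : ℤ → ℝ) (J : ℤ → Set ℝ)
    (hJ : ∀ k, IsSplitting F (J k)) (W : Finset ℤ) (hf : MemLp f 2 P) :
    ∃ ν : Measure (Compacts ℝ), ∀ U : Set ℝ, MeasurableSet {M : Compacts ℝ | (M : Set ℝ) ⊆ U} →
      ν {M : Compacts ℝ | (M : Set ℝ) ⊆ U} =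
        ENNReal.ofReal (mass P F f (⋃ k ∈ W, {x ∈ J k | c k ∉ U})ᶜ) := by
  classical
  have := hF.prob
  induction W using Finset.induction_on generalizing f with
  | empty =>
    refine ⟨ENNReal.ofReal (mass P F f Set.univ) • Measure.dirac ⊥, fun U hU => ?_⟩
    rw [Measure.smul_apply, Measure.dirac_apply' _ hU]
    simp
  | insert a W ha ih =>
    -- The part of f measurable off `J a` has spectral sets missing that cell; the remainder has
    -- spectral sets hitting it, so the mark `c a` is added to its law.
    obtain ⟨ν₁, h₁⟩ := ih (memLp_condExp_two (m := sigmaField F (J a)ᶜ) hf)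
    obtain ⟨ν₂, h₂⟩ := ih (hf.sub (memLp_condExp_two (m := sigmaField F (J a)ᶜ) hf))
    have hcont : Continuous fun M : Compacts ℝ => M ⊔ {c a} := by fun_prop
    refine ⟨ν₁ + ν₂.map fun M => M ⊔ {c a}, fun U hU => ?_⟩
    have hpre : (fun M : Compacts ℝ => M ⊔ {c a}) ⁻¹' {M : Compacts ℝ | (M : Set ℝ) ⊆ U} =
        if c a ∈ U then {M : Compacts ℝ | (M : Set ℝ) ⊆ U} else ∅ := by
      ext M
      split_ifs with h <;> simp [h, Set.insert_subset_iff]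
    have hsplit : IsSplitting F (⋃ k ∈ W, {x ∈ J k | c k ∉ U})ᶜ := by
      refine (IsSplitting.biUnion W fun k _ => ?_).compl
      by_cases hk : c k ∈ U
      · simpa [hk] using isSplitting_empty
      · simpa [hk] using hJ k
    rw [Measure.add_apply, Measure.map_apply hcont.measurable hU, hpre, h₁ U hU,
      hF.mass_condExp hsplit _ hf, Finset.set_biUnion_insert]
    by_cases h : c a ∈ U
    · rw [if_pos h, h₂ U hU, hF.mass_sub_condExp hsplit (hJ a).compl hf, Set.inter_comm,
        ← ENNReal.ofReal_add (mass_nonneg _ _)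
          (sub_nonneg.2 (hF.mass_mono hf Set.inter_subset_left))]
      simp [h]
    · rw [if_neg h, measure_empty, add_zero, Set.compl_union]
      simp [h]

end IsContinuousFactorization

end Mass


/-! ### Comparison of dyadic discretizations with inner and outer approximations of a set. -/

/-- The complement of the union of all dyadic half-open cells of level `n` in the window `[-n, n)`
with left endpoint outside `U`. -/
def gridSet (n : ℕ) (U : Set ℝ) : Set ℝ :=
  (⋃ k ∈ Finset.Ico (-(n * 2 ^ n) : ℤ) (n * 2 ^ n),
    {x ∈ Set.Ico (dyadic n k) (dyadic n (k + 1)) | dyadic n k ∉ U})ᶜ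

theorem mem_gridSet_of_forall {n : ℕ} {U : Set ℝ} {x : ℝ}
    (h : ∀ y ∈ Set.Icc (x - 1 / 2 ^ n) x, y ∈ U) : x ∈ gridSet n U := by
  simp only [gridSet, Set.mem_compl_iff, Set.mem_iUnion, not_exists]
  rintro k - ⟨hx, hk⟩
  rw [dyadic_add_one] at hx
  exact hk (h _ ⟨by linarith [hx.2], hx.1⟩)

theorem exists_of_mem_gridSet {n : ℕ} {U : Set ℝ} {x : ℝ} (hx : x ∈ gridSet n U) (hxn : |x| < n) :
    ∃ y ∈ Set.Icc (x - 1 / 2 ^ n) x, y ∈ U := by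
  simp only [gridSet, Set.mem_compl_iff, Set.mem_iUnion, not_exists] at hx
  have h2 : (0 : ℝ) < 2 ^ n := by positivity
  have hx' := abs_lt.1 hxn
  have h1 : dyadic n ⌊x * 2 ^ n⌋ ≤ x := by
    rw [dyadic, div_le_iff₀ h2]; exact Int.floor_le _
  have h3 : x < dyadic n (⌊x * 2 ^ n⌋ + 1) := by
    rw [dyadic, lt_div_iff₀ h2]; push_cast; exact Int.lt_floor_add_one _
  have h4 := h3
  rw [dyadic_add_one] at h4
  refine ⟨dyadic n ⌊x * 2 ^ n⌋, ⟨by linarith, h1⟩, ?_⟩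
  by_contra hU
  refine hx ⌊x * 2 ^ n⌋ ?_ ⟨⟨h1, h3⟩, hU⟩
  rw [Finset.mem_Ico, Int.le_floor, Int.floor_lt]
  push_cast
  constructor
  · rw [← neg_mul]; gcongr; exact hx'.1.le
  · gcongr; exact hx'.2

/-- The index 2j + 1 halves the depth exactly, 1/((2j + 1) + 1) = 1/(2(j + 1)), which leaves room to
move by the other half; the window grows by more than the move. -/
theorem mem_erosion_of_mem_erosion {j : ℕ} {E : Set ℝ} {x y : ℝ} (hx : x ∈ erosion j E)
    (hyx : |y - x| ≤ 1 / (2 * (j + 1))) : y ∈ erosion (2 * j + 1) E := by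
  have hj : (0 : ℝ) ≤ j := Nat.cast_nonneg j
  have h1 : (1 : ℝ) / (2 * (j + 1)) ≤ 1 := by
    rw [div_le_one (by positivity)]; linarith
  have h2 : (1 : ℝ) / ((2 * j + 1 : ℕ) + 1) = 1 / (2 * (j + 1)) := by push_cast; ring
  have h3 : (1 : ℝ) / (j + 1) = 1 / (2 * (j + 1)) + 1 / (2 * (j + 1)) := by field_simp; norm_num
  have h4 := abs_le.1 hyx
  have h5 := abs_le.1 hx.1
  refine ⟨?_, (Set.Icc_subset_Icc ?_ ?_).trans hx.2⟩
  · rw [abs_le]; push_cast; constructor <;> linarith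
  · rw [h2, h3]; linarith
  · rw [h2, h3]; linarith

theorem closure_erosion_subset (n : ℕ) (E : Set ℝ) : closure (erosion n E) ⊆ E := by
  intro x hx
  obtain ⟨y, hy, hxy⟩ := Metric.mem_closure_iff.1 hx (1 / (n + 1)) (by positivity)
  rw [Real.dist_eq, abs_lt] at hxy
  exact hy.2 ⟨by linarith [hxy.1], by linarith [hxy.2]⟩

/-- Rounding down to level n moves points by at most 2⁻ⁿ, eventually less than the spare depth. With
`eventually_gridSet_subset` this squeezes the discretized masses from both sides. -/
theorem eventually_erosion_subset_gridSet (j : ℕ) (E : Set ℝ) :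
    ∀ᶠ n in atTop, erosion j E ⊆ gridSet n (closure (erosion (2 * j + 1) E)) := by
  have h := (tendsto_pow_atTop_nhds_zero_of_lt_one (r := (1 / 2 : ℝ)) (by norm_num)
    (by norm_num)).eventually_le_const (show (0 : ℝ) < 1 / (2 * (j + 1)) by positivity)
  filter_upwards [h] with n hn x hx
  rw [one_div_pow] at hn
  refine mem_gridSet_of_forall fun y hy => subset_closure (mem_erosion_of_mem_erosion hx ?_)
  rw [abs_le]
  constructor <;> linarith [hy.1, hy.2, show (0 : ℝ) ≤ 1 / 2 ^ n by positivity]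

theorem eventually_gridSet_subset (j : ℕ) (E : Set ℝ) :
    ∀ᶠ n in atTop, gridSet n (closure (erosion (2 * j + 1) Eᶜ))ᶜ ⊆ (erosion j Eᶜ)ᶜ := by
  have h := (tendsto_pow_atTop_nhds_zero_of_lt_one (r := (1 / 2 : ℝ)) (by norm_num)
    (by norm_num)).eventually_le_const (show (0 : ℝ) < 1 / (2 * (j + 1)) by positivity)
  filter_upwards [h, eventually_gt_atTop j] with n hn hjn x hx hxe
  rw [one_div_pow] at hn
  obtain ⟨y, hy, hyU⟩ := exists_of_mem_gridSet hx (hxe.1.trans_lt (by exact_mod_cast hjn))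
  refine hyU (subset_closure (mem_erosion_of_mem_erosion hxe ?_))
  rw [abs_le]
  constructor <;> linarith [hy.1, hy.2, show (0 : ℝ) ≤ 1 / 2 ^ n by positivity]

/-! ### Existence of spectral measures. -/

section Existence

variable {Ω : Type*} {mΩ : MeasurableSpace Ω} {P : Measure Ω} {F : ℝ → ℝ → MeasurableSpace Ω}
  {f g : Ω → ℝ} {D D' E : Set ℝ}

theorem mass_smul (c : ℝ) (E : Set ℝ) :
    mass P F (c • f) E = c ^ 2 * mass P F f E := by
  unfold mass
  rw [← integral_const_mul]
  refine integral_congr_ae ?_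
  filter_upwards [condExp_smul (μ := P) c f (sigmaField F E)] with x hx
  rw [hx, Pi.smul_apply, smul_eq_mul, mul_pow]

namespace IsContinuousFactorization

variable (hF : IsContinuousFactorization P F)
include hF

theorem exists_mass_Icc_gt (hf : MemLp f 2 P) {c : ℝ} (hc : c < ∫ x, f x ^ 2 ∂P) :
    ∃ n : ℕ, c < mass P F f (Set.Icc (-(n : ℝ)) n) := by
  have := hF.prob
  by_contra! hcon
  have hmono : Monotone fun n : ℕ => sigmaField F (Set.Icc (-(n : ℝ)) n) := by
    intro n k hnk
    have : (n : ℝ) ≤ k := by exact_mod_cast hnk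
    exact sigmaField_mono (Set.Icc_subset_Icc (by linarith) this)
  have h := integral_condExp_iSup_sq_le hmono (fun n => hF.sigmaField_le _) hf hcon
  have hsup : ⨆ n : ℕ, sigmaField F (Set.Icc (-(n : ℝ)) n) = mΩ := by
    apply le_antisymm (iSup_le fun n => hF.sigmaField_le _)
    conv_lhs => rw [← hF.exhaust]
    refine iSup₂_le fun n hn => le_trans ?_ (le_iSup _ n)
    exact le_sigmaField (by linarith [show (0 : ℝ) ≤ n from Nat.cast_nonneg n])
      Set.Ioo_subset_Icc_self
  rw [hsup] at h
  have h2 : ∫ x, (P[f|mΩ]) x ^ 2 ∂P = ∫ x, f x ^ 2 ∂P := by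
    refine integral_congr_ae ?_
    filter_upwards [condExp_ae_of_aestronglyMeasurable le_rfl hf.1 hf] with x hx
    rw [hx]
  linarith

theorem mass_sub_le_gridSet (hf : MemLp f 2 P) (n N : ℕ) :
    mass P F f (Set.Icc (-(N : ℝ)) N) ≤
      mass P F f (gridSet n (Set.Icc (-((N : ℝ) + 1)) (N + 1))) := by
  refine hF.mass_mono hf fun x hx => mem_gridSet_of_forall fun y hy => ?_
  have h1 : (1 : ℝ) / 2 ^ n ≤ 1 := by
    rw [div_le_one (by positivity)]; exact one_le_pow₀ (by norm_num)
  constructor <;> linarith [hx.1, hx.2, hy.1, hy.2]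

/-- The discretized spectral laws are probability measures, tight because most of the mass sits on
subsets of one bounded interval and these form a compact set. A weak limit has the right values on
{M ⊆ E}: the portmanteau inequalities for open and closed sets match the upper and lower continuity
of the masses. -/
theorem exists_isSpectralMeasure_of_norm_eq_one (hf : MemLp f 2 P)
    (h1 : ∫ x, f x ^ 2 ∂P = 1) :
    ∃ μ : Measure (Compacts ℝ), IsSpectralMeasure P F f μ := by
  have hP := hF.prob
  choose ν hν using fun n : ℕ => hF.exists_discrete_spectral_measure (dyadic n)
    (fun k => Set.Ico (dyadic n k) (dyadic n (k + 1)))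
    (fun k => hF.isSplitting_of_ordConnected Set.ordConnected_Ico)
    (Finset.Ico (-(n * 2 ^ n) : ℤ) (n * 2 ^ n)) hf
  replace hν : ∀ (n : ℕ) (U : Set ℝ), MeasurableSet {M : Compacts ℝ | (M : Set ℝ) ⊆ U} →
      ν n {M : Compacts ℝ | (M : Set ℝ) ⊆ U} = ENNReal.ofReal (mass P F f (gridSet n U)) := hν
  have hprob : ∀ n, IsProbabilityMeasure (ν n) := by
    intro n
    refine ⟨?_⟩
    have := hν n Set.univ (by simp)
    simpa [gridSet, hF.mass_univ hf, h1] using this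
  let p : ℕ → ProbabilityMeasure (Compacts ℝ) := fun n => ⟨ν n, hprob n⟩
  have hp : ∀ n, ((p n : ProbabilityMeasure (Compacts ℝ)) : Measure (Compacts ℝ)) = ν n :=
    fun n => rfl
  have htight : IsTightMeasureSet
      {((μ : ProbabilityMeasure (Compacts ℝ)) : Measure (Compacts ℝ)) | μ ∈ Set.range p} := by
    rw [isTightMeasureSet_iff_exists_isCompact_measure_compl_le]
    intro ε hε
    obtain ⟨δ, hδ, hδε⟩ : ∃ δ : ℝ, 0 < δ ∧ ENNReal.ofReal δ ≤ ε := by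
      rcases eq_or_ne ε ⊤ with rfl | hne
      · exact ⟨1, one_pos, le_top⟩
      · exact ⟨ε.toReal, ENNReal.toReal_pos hε.ne' hne, by rw [ENNReal.ofReal_toReal hne]⟩
    -- Marks are at distance at most 2⁻ⁿ ≤ 1 from the points they replace, so enlarging [-N, N] by 1
    -- works for all levels at once.
    obtain ⟨N, hN⟩ := hF.exists_mass_Icc_gt hf (c := 1 - δ) (by linarith)
    have hcpt : IsCompact {M : Compacts ℝ | (M : Set ℝ) ⊆ Set.Icc (-((N : ℝ) + 1)) (N + 1)} :=
      Compacts.isCompact_subsets_of_isCompact isCompact_Icc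
    refine ⟨_, hcpt, ?_⟩
    rintro _ ⟨_, ⟨n, rfl⟩, rfl⟩
    rw [hp, prob_compl_eq_one_sub hcpt.measurableSet, hν n _ hcpt.measurableSet]
    refine le_trans ?_ hδε
    rw [← ENNReal.ofReal_one, ← ENNReal.ofReal_sub _ (mass_nonneg _ _)]
    refine ENNReal.ofReal_le_ofReal ?_
    linarith [hF.mass_sub_le_gridSet hf n N]
  -- Relative compactness is Prokhorov's theorem; a limit along an ultrafilter replaces the
  -- extraction of a subsequence.
  obtain ⟨μ, -, hμ⟩ := (isCompact_closure_of_isTightMeasureSet htight).ultrafilter_le_nhds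
    ((hyperfilter ℕ).map p) (by
      rw [le_principal_iff]
      exact Filter.mem_map.2 (Filter.Eventually.of_forall fun n => subset_closure ⟨n, rfl⟩))
  have hlim : Tendsto p (hyperfilter ℕ) (𝓝 μ) := hμ
  have hat : ∀ {q : ℕ → Prop}, (∀ᶠ n in atTop, q n) → ∀ᶠ n in (hyperfilter ℕ : Filter ℕ), q n :=
    fun h => Nat.hyperfilter_le_atTop h
  refine ⟨μ, (isSpectralMeasure_iff hf).2 fun E hE => ?_⟩
  have hsplit := hF.isSplitting_of_isElementary hE
  have hfin : (μ : Measure (Compacts ℝ)) {M : Compacts ℝ | (M : Set ℝ) ⊆ E} ≠ ⊤ :=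
    measure_ne_top _ _
  apply le_antisymm
  · rw [← ENNReal.ofReal_toReal hfin]
    refine ENNReal.ofReal_le_ofReal (hF.le_mass_of_erosion hf hsplit fun j => ?_)
    rw [← ENNReal.ofReal_le_ofReal_iff (mass_nonneg _ _), ENNReal.ofReal_toReal hfin]
    set U : Set ℝ := (closure (erosion (2 * j + 1) Eᶜ))ᶜ with hU
    have hUo : IsOpen {M : Compacts ℝ | (M : Set ℝ) ⊆ U} :=
      Compacts.isOpen_subsets_of_isOpen isClosed_closure.isOpen_compl
    have hEU : E ⊆ U := Set.subset_compl_comm.1 (closure_erosion_subset _ Eᶜ)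
    have hsub : {M : Compacts ℝ | (M : Set ℝ) ⊆ E} ⊆ {M : Compacts ℝ | (M : Set ℝ) ⊆ U} :=
      fun M hM => Set.Subset.trans hM hEU
    refine (measure_mono hsub).trans ((ProbabilityMeasure.le_liminf_measure_open_of_tendsto hlim hUo).trans ?_)
    refine liminf_le_of_frequently_le' ?_
    refine (hat ?_).frequently
    filter_upwards [eventually_gridSet_subset j E] with n hn
    rw [hp, hν n U hUo.measurableSet]
    exact ENNReal.ofReal_le_ofReal (hF.mass_mono hf hn)
  · rw [← ENNReal.ofReal_toReal hfin]
    refine ENNReal.ofReal_le_ofReal (hF.mass_le_of_erosion hf E fun j => ?_)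
    rw [← ENNReal.ofReal_le_ofReal_iff ENNReal.toReal_nonneg, ENNReal.ofReal_toReal hfin]
    set C : Set ℝ := closure (erosion (2 * j + 1) E) with hC
    have hCc : IsClosed {M : Compacts ℝ | (M : Set ℝ) ⊆ C} :=
      Compacts.isClosed_subsets_of_isClosed isClosed_closure
    refine le_trans ?_ ((ProbabilityMeasure.limsup_measure_closed_le_of_tendsto hlim hCc).trans
      (measure_mono fun M (hM : (M : Set ℝ) ⊆ C) => hM.trans (closure_erosion_subset _ E)))
    refine le_limsup_of_frequently_le' ?_
    refine (hat ?_).frequently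
    filter_upwards [eventually_erosion_subset_gridSet j E] with n hn
    rw [hp, hν n C hCc.measurableSet]
    exact ENNReal.ofReal_le_ofReal (hF.mass_mono hf hn)

/-- Every square integrable random variable has a spectral measure. -/
theorem exists_isSpectralMeasure (hf : MemLp f 2 P) :
    ∃ μ : Measure (Compacts ℝ), IsSpectralMeasure P F f μ := by
  have := hF.prob
  rcases eq_or_ne (∫ x, f x ^ 2 ∂P) 0 with h0 | h0
  · refine ⟨0, (isSpectralMeasure_iff hf).2 fun E hE => ?_⟩
    have h1 := hF.mass_mono hf (Set.subset_univ E)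
    rw [hF.mass_univ hf, h0] at h1
    simp [ENNReal.ofReal_of_nonpos h1]
  · set a := ∫ x, f x ^ 2 ∂P with ha
    have hpos : 0 < a := lt_of_le_of_ne (integral_nonneg fun _ => sq_nonneg _) h0.symm
    set c := (Real.sqrt a)⁻¹ with hc
    have hc2 : c ^ 2 = a⁻¹ := by rw [hc, inv_pow, Real.sq_sqrt hpos.le]
    have hg : MemLp (c • f) 2 P := hf.const_smul c
    obtain ⟨μ, hμ⟩ := hF.exists_isSpectralMeasure_of_norm_eq_one hg (by
      rw [← hF.mass_univ hg, mass_smul, hF.mass_univ hf, ← ha, hc2, inv_mul_cancel₀ h0])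
    refine ⟨ENNReal.ofReal a • μ, (isSpectralMeasure_iff hf).2 fun E hE => ?_⟩
    rw [Measure.smul_apply, (isSpectralMeasure_iff hg).1 hμ E hE, mass_smul, hc2,
      smul_eq_mul, ← ENNReal.ofReal_mul hpos.le, mul_inv_cancel_left₀ h0]

end IsContinuousFactorization

end Existence


/-! ### Elementary sets and the Borel σ-field of the space of compacts. -/

theorem isElementary_of_ordConnected {J : Set ℝ} (hJ : J.OrdConnected) : IsElementary J :=
  ⟨{J}, Set.finite_singleton J, by simpa using hJ, by simp⟩

theorem IsElementary.union {E E' : Set ℝ} (h : IsElementary E) (h' : IsElementary E') :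
    IsElementary (E ∪ E') := by
  obtain ⟨S, hS, hJ, rfl⟩ := h
  obtain ⟨S', hS', hJ', rfl⟩ := h'
  refine ⟨S ∪ S', hS.union hS', ?_, Set.sUnion_union _ _ |>.symm⟩
  rintro J (h | h)
  exacts [hJ J h, hJ' J h]

theorem IsElementary.inter {E E' : Set ℝ} (h : IsElementary E) (h' : IsElementary E') :
    IsElementary (E ∩ E') := by
  obtain ⟨S, hS, hJ, rfl⟩ := h
  obtain ⟨S', hS', hJ', rfl⟩ := h'
  refine ⟨Set.image2 (· ∩ ·) S S', hS.image2 _ hS', ?_, ?_⟩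
  · rintro _ ⟨J, hJS, J', hJS', rfl⟩
    exact (hJ J hJS).inter (hJ' J' hJS')
  · ext x
    simp only [Set.mem_inter_iff, Set.mem_sUnion, Set.mem_image2]
    constructor
    · rintro ⟨⟨J, h1, h2⟩, J', h3, h4⟩
      exact ⟨_, ⟨J, h1, J', h3, rfl⟩, h2, h4⟩
    · rintro ⟨_, ⟨J, h1, J', h3, rfl⟩, h2, h4⟩
      exact ⟨⟨J, h1, h2⟩, J', h3, h4⟩

theorem isElementary_univ : IsElementary Set.univ :=
  isElementary_of_ordConnected Set.ordConnected_univ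

theorem isElementary_compl_of_ordConnected {J : Set ℝ} (hJ : J.OrdConnected) :
    IsElementary Jᶜ := by
  by_cases hne : J.Nonempty
  · obtain ⟨c, hc⟩ := hne
    have h1 : (Jᶜ ∩ Set.Iio c).OrdConnected := by
      refine ⟨fun x hx y hy z hz => ⟨fun hzJ => hy.1 (hJ.out hzJ hc ⟨hz.2, le_of_lt hy.2⟩), ?_⟩⟩
      exact lt_of_le_of_lt hz.2 hy.2
    have h2 : (Jᶜ ∩ Set.Ioi c).OrdConnected := by
      refine ⟨fun x hx y hy z hz => ⟨fun hzJ => hx.1 (hJ.out hc hzJ ⟨le_of_lt hx.2, hz.1⟩), ?_⟩⟩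
      exact lt_of_lt_of_le hx.2 hz.1
    have h3 : Jᶜ = (Jᶜ ∩ Set.Iio c) ∪ (Jᶜ ∩ Set.Ioi c) := by
      ext x
      rcases lt_trichotomy x c with h | rfl | h
      · simp [h, h.not_gt]
      · simp [hc]
      · simp [h, h.not_gt]
    rw [h3]
    exact (isElementary_of_ordConnected h1).union (isElementary_of_ordConnected h2)
  · rw [Set.not_nonempty_iff_eq_empty.1 hne, Set.compl_empty]
    exact isElementary_univ

/-- The events `{M ⊆ E}` for elementary `E`. -/
def subsetEvents : Set (Set (Compacts ℝ)) :=
  {S | ∃ E : Set ℝ, IsElementary E ∧ S = {M : Compacts ℝ | (M : Set ℝ) ⊆ E}}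

theorem isPiSystem_subsetEvents : IsPiSystem subsetEvents := by
  rintro _ ⟨E, hE, rfl⟩ _ ⟨E', hE', rfl⟩ -
  exact ⟨E ∩ E', hE.inter hE', by ext M; simp⟩

/-- An interval differs from its interior by at most its two endpoints. This makes {M ⊆ E} a
countable intersection of open sets for elementary E. -/
theorem isGδ_of_ordConnected {J : Set ℝ} (hJ : J.OrdConnected) : IsGδ J := by
  have h : J \ interior J ⊆ {sInf J, sSup J} := by
    rintro x ⟨hx, hxi⟩
    by_contra hcon
    simp only [Set.mem_insert_iff, Set.mem_singleton_iff, not_or] at hcon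
    obtain ⟨y, hy, hyx⟩ : ∃ y ∈ J, y < x := by
      by_contra! hmin
      exact hcon.1 (IsLeast.csInf_eq ⟨hx, hmin⟩).symm
    obtain ⟨z, hz, hxz⟩ : ∃ z ∈ J, x < z := by
      by_contra! hmax
      exact hcon.2 (IsGreatest.csSup_eq ⟨hx, hmax⟩).symm
    exact hxi (mem_interior.2 ⟨Set.Ioo y z, Set.Ioo_subset_Icc_self.trans (hJ.out hy hz),
      isOpen_Ioo, hyx, hxz⟩)
  rw [← Set.union_sdiff_cancel (interior_subset (s := J))]
  exact isOpen_interior.isGδ.union ((Set.toFinite {sInf J, sSup J}).subset h).isGδ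

theorem IsElementary.isGδ {E : Set ℝ} (hE : IsElementary E) : IsGδ E := by
  obtain ⟨S, hS, hJ, rfl⟩ := hE
  exact IsGδ.sUnion hS fun J hJS => isGδ_of_ordConnected (hJ J hJS)

theorem measurableSet_subsets {E : Set ℝ} (hE : IsElementary E) :
    MeasurableSet {M : Compacts ℝ | (M : Set ℝ) ⊆ E} := by
  obtain ⟨T, hT, hTc, rfl⟩ := hE.isGδ
  have h : {M : Compacts ℝ | (M : Set ℝ) ⊆ ⋂₀ T} =
      ⋂ U ∈ T, {M : Compacts ℝ | (M : Set ℝ) ⊆ U} := by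
    ext M; simp [Set.subset_sInter_iff]
  rw [h]
  exact MeasurableSet.biInter hTc fun U hU =>
    (Compacts.isOpen_subsets_of_isOpen (hT U hU)).measurableSet

/-- A countable basis of the topology consists of the sets K contained in a finite union of rational
intervals and hitting each of them. Hitting U is the complement of being contained in Uᶜ, and Uᶜ is
elementary too. -/
theorem measurableSpace_compacts_eq :
    instMeasurableSpaceCompacts = MeasurableSpace.generateFrom subsetEvents := by
  have hgen : ∀ E : Set ℝ, IsElementary E →
      MeasurableSet[MeasurableSpace.generateFrom subsetEvents] {M : Compacts ℝ | (M : Set ℝ) ⊆ E} :=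
    fun E hE => MeasurableSpace.measurableSet_generateFrom ⟨E, hE, rfl⟩
  have hne : ∀ U : Set ℝ, {M : Compacts ℝ | ((M : Set ℝ) ∩ U).Nonempty} =
      {M : Compacts ℝ | (M : Set ℝ) ⊆ Uᶜ}ᶜ := by
    intro U
    ext M
    simp [Set.subset_compl_iff_disjoint_right, Set.not_disjoint_iff_nonempty_inter]
  apply le_antisymm
  · change borel (Compacts ℝ) ≤ _
    rw [Real.isTopologicalBasis_Ioo_rat.compacts.borel_eq_generateFrom]
    refine MeasurableSpace.generateFrom_le ?_
    rintro _ ⟨u, ⟨hu, huB⟩, rfl⟩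
    have hord : ∀ U ∈ u, U.OrdConnected := by
      intro U hU
      obtain ⟨a, b, h⟩ : ∃ a b : ℝ, U = Set.Ioo a b := by
        have := huB hU
        simp only [Set.mem_iUnion, Set.mem_singleton_iff] at this
        obtain ⟨a, b, -, h⟩ := this
        exact ⟨a, b, h⟩
      rw [h]
      exact Set.ordConnected_Ioo
    have h1 : {K : Compacts ℝ | (K : Set ℝ) ⊆ ⋃₀ u ∧ ∀ U ∈ u, ((K : Set ℝ) ∩ U).Nonempty} =
        {K : Compacts ℝ | (K : Set ℝ) ⊆ ⋃₀ u} ∩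
          ⋂ U ∈ u, {K : Compacts ℝ | ((K : Set ℝ) ∩ U).Nonempty} := by
      ext K; simp
    change MeasurableSet[MeasurableSpace.generateFrom subsetEvents] {K : Compacts ℝ |
      (K : Set ℝ) ⊆ ⋃₀ u ∧ ∀ U ∈ u, ((K : Set ℝ) ∩ U).Nonempty}
    rw [h1]
    refine @MeasurableSet.inter _ (_) _ _ (hgen _ ⟨u, hu, hord, rfl⟩)
      (@MeasurableSet.biInter _ _ (_) _ _ hu.countable fun U hU => ?_)
    rw [hne]
    exact @MeasurableSet.compl _ _ (_) (hgen _ (isElementary_compl_of_ordConnected (hord U hU)))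
  · refine MeasurableSpace.generateFrom_le ?_
    rintro _ ⟨E, hE, rfl⟩
    exact measurableSet_subsets hE

theorem ext_of_subsetEvents {μ μ' : Measure (Compacts ℝ)} [IsFiniteMeasure μ]
    (h : ∀ E : Set ℝ, IsElementary E → μ {M : Compacts ℝ | (M : Set ℝ) ⊆ E} =
      μ' {M : Compacts ℝ | (M : Set ℝ) ⊆ E}) : μ = μ' := by
  refine ext_of_generate_finite subsetEvents measurableSpace_compacts_eq isPiSystem_subsetEvents
    ?_ ?_
  · rintro _ ⟨E, hE, rfl⟩
    exact h E hE
  · simpa using h Set.univ isElementary_univ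

theorem measurable_of_subsetEvents {α : Type*} [MeasurableSpace α] {φ : α → Compacts ℝ}
    (h : ∀ E : Set ℝ, IsElementary E → MeasurableSet {a | (φ a : Set ℝ) ⊆ E}) : Measurable φ := by
  rw [measurableSpace_compacts_eq]
  refine measurable_generateFrom ?_
  rintro _ ⟨E, hE, rfl⟩
  exact h E hE

/-- The trace of a compact set on a closed set. -/
def trace (K : Set ℝ) (hK : IsClosed K) (M : Compacts ℝ) : Compacts ℝ :=
  ⟨M ∩ K, M.isCompact.inter_right hK⟩

theorem setOf_trace_subset (K : Set ℝ) (hK : IsClosed K) (E : Set ℝ) :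
    {M : Compacts ℝ | (trace K hK M : Set ℝ) ⊆ E} = {M : Compacts ℝ | (M : Set ℝ) ⊆ E ∪ Kᶜ} := by
  ext M
  simp only [trace, Compacts.coe_mk, Set.mem_ofPred_eq, Set.inter_subset, Set.union_comm E]

theorem measurable_trace {K : Set ℝ} (hK : IsClosed K) (hKe : IsElementary Kᶜ) :
    Measurable (trace K hK) := by
  refine measurable_of_subsetEvents fun E hE => ?_
  rw [setOf_trace_subset]
  exact measurableSet_subsets (hE.union hKe)

theorem memLp_mul_of_bound {Ω : Type*} {mΩ : MeasurableSpace Ω} {P : Measure Ω} {h u : Ω → ℝ}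
    (hm : AEStronglyMeasurable h P) (hbd : ∀ᵐ x ∂P, ‖h x‖ ≤ 1) (hu : MemLp u 2 P) :
    MemLp (h * u) 2 P := by
  refine hu.of_le (hm.mul hu.1) ?_
  filter_upwards [hbd] with x hx
  rw [Pi.mul_apply, norm_mul]
  exact mul_le_of_le_one_left (norm_nonneg _) hx

/-! ### Spectral measures under sums, limits, conditioning and multiplication by signs. -/

section Spectrum

variable {Ω : Type*} {mΩ : MeasurableSpace Ω} {P : Measure Ω} {F : ℝ → ℝ → MeasurableSpace Ω}
  {f g : Ω → ℝ} {D E : Set ℝ} {I : Set (Compacts ℝ)} {μ μ' ν : Measure (Compacts ℝ)}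

theorem IsSpectralMeasure.congr (h : f =ᵐ[P] g) (hμ : IsSpectralMeasure P F f μ) :
    IsSpectralMeasure P F g μ := by
  intro E hE
  rw [hμ E hE, eLpNorm_congr_ae (condExp_congr_ae h)]

theorem SpectrumIn.congr (h : f =ᵐ[P] g) (hf : SpectrumIn P F f I) : SpectrumIn P F g I := by
  obtain ⟨μ, hμ, h0⟩ := hf
  exact ⟨μ, hμ.congr h, h0⟩

theorem IsSpectralMeasure.isFiniteMeasure [IsProbabilityMeasure P] (hf : MemLp f 2 P)
    (hμ : IsSpectralMeasure P F f μ) : IsFiniteMeasure μ := by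
  constructor
  have := (isSpectralMeasure_iff hf).1 hμ Set.univ isElementary_univ
  simp only [Set.subset_univ, Set.ofPred_true] at this
  rw [this]
  exact ENNReal.ofReal_lt_top

theorem IsSpectralMeasure.smul [IsProbabilityMeasure P] (hf : MemLp f 2 P)
    (hμ : IsSpectralMeasure P F f μ) (c : ℝ) :
    IsSpectralMeasure P F (c • f) (ENNReal.ofReal (c ^ 2) • μ) := by
  rw [isSpectralMeasure_iff (hf.const_smul c)]
  intro E hE
  rw [Measure.smul_apply, (isSpectralMeasure_iff hf).1 hμ E hE, mass_smul, smul_eq_mul,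
    ENNReal.ofReal_mul (sq_nonneg c)]

theorem SpectrumIn.smul [IsProbabilityMeasure P] (hf : MemLp f 2 P) (h : SpectrumIn P F f I)
    (c : ℝ) : SpectrumIn P F (c • f) I := by
  obtain ⟨μ, hμ, h0⟩ := h
  exact ⟨_, hμ.smul hf c, by simp [h0]⟩

/-- The parallelogram identity for spectral measures. -/
theorem IsSpectralMeasure.parallelogram [IsProbabilityMeasure P] (hf : MemLp f 2 P)
    (hg : MemLp g 2 P) (hμ : IsSpectralMeasure P F f μ) (hν : IsSpectralMeasure P F g ν)
    {μ₁ μ₂ : Measure (Compacts ℝ)} (h₁ : IsSpectralMeasure P F (f + g) μ₁)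
    (h₂ : IsSpectralMeasure P F (f - g) μ₂) : μ₁ + μ₂ = (2 : ENNReal) • (μ + ν) := by
  have := h₁.isFiniteMeasure (hf.add hg)
  have := h₂.isFiniteMeasure (hf.sub hg)
  refine ext_of_subsetEvents fun E hE => ?_
  simp only [Measure.add_apply, Measure.smul_apply, smul_eq_mul]
  rw [(isSpectralMeasure_iff (hf.add hg)).1 h₁ E hE, (isSpectralMeasure_iff (hf.sub hg)).1 h₂ E hE,
    (isSpectralMeasure_iff hf).1 hμ E hE, (isSpectralMeasure_iff hg).1 hν E hE,
    ← ENNReal.ofReal_add (mass_nonneg _ _) (mass_nonneg _ _),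
    ← ENNReal.ofReal_add (mass_nonneg _ _) (mass_nonneg _ _), ← ENNReal.ofReal_ofNat 2,
    ← ENNReal.ofReal_mul zero_le_two]
  congr 1
  have h3 : mass P F (f + g) E =
      ∫ x, ((P[f|sigmaField F E]) x + (P[g|sigmaField F E]) x) ^ 2 ∂P := by
    refine integral_congr_ae ?_
    filter_upwards [condExp_add (integrable_of_memLp_two hf) (integrable_of_memLp_two hg)
      (sigmaField F E)] with x hx
    rw [hx, Pi.add_apply]
  have h4 : mass P F (f - g) E =
      ∫ x, ((P[f|sigmaField F E]) x - (P[g|sigmaField F E]) x) ^ 2 ∂P := by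
    refine integral_congr_ae ?_
    filter_upwards [condExp_sub (integrable_of_memLp_two hf) (integrable_of_memLp_two hg)
      (sigmaField F E)] with x hx
    rw [hx, Pi.sub_apply]
  rw [h3, h4, integral_sq_add (memLp_condExp_two hf) (memLp_condExp_two hg),
    integral_sq_sub (memLp_condExp_two hf) (memLp_condExp_two hg)]
  unfold mass
  ring

namespace IsContinuousFactorization

variable (hF : IsContinuousFactorization P F)
include hF

theorem spectrumIn_add (hf : MemLp f 2 P) (hg : MemLp g 2 P) (hfI : SpectrumIn P F f I)
    (hgI : SpectrumIn P F g I) : SpectrumIn P F (f + g) I := by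
  have := hF.prob
  obtain ⟨μ, hμ, hμ0⟩ := hfI
  obtain ⟨ν, hν, hν0⟩ := hgI
  obtain ⟨μ₁, h₁⟩ := hF.exists_isSpectralMeasure (hf.add hg)
  obtain ⟨μ₂, h₂⟩ := hF.exists_isSpectralMeasure (hf.sub hg)
  refine ⟨μ₁, h₁, ?_⟩
  have h := congrArg (fun m : Measure (Compacts ℝ) => m Iᶜ) (hμ.parallelogram hf hg hν h₁ h₂)
  simp only [Measure.add_apply, Measure.smul_apply, hμ0, hν0, add_zero, smul_zero,
    add_eq_zero] at h
  exact h.1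

/-- The parallelogram identity for g and f - g bounds μ_f(Iᶜ) by 2‖f - g‖² whenever μ_g(Iᶜ) = 0. -/
theorem spectrumIn_of_forall_dist_lt (hf : MemLp f 2 P)
    (h : ∀ ε > 0, ∃ g, MemLp g 2 P ∧ SpectrumIn P F g I ∧ ∫ x, (f x - g x) ^ 2 ∂P < ε) :
    SpectrumIn P F f I := by
  have := hF.prob
  obtain ⟨μ, hμ⟩ := hF.exists_isSpectralMeasure hf
  refine ⟨μ, hμ, ?_⟩
  by_contra h0
  have hfin := hμ.isFiniteMeasure hf
  have hpos : 0 < (μ Iᶜ).toReal := ENNReal.toReal_pos h0 (measure_ne_top _ _)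
  -- Half of μ(Iᶜ) compensates the factor 2 of the parallelogram identity.
  obtain ⟨g, hg, ⟨ν, hν, hν0⟩, hlt⟩ := h ((μ Iᶜ).toReal / 2) (by positivity)
  have hd := hf.sub hg
  obtain ⟨ν', hν'⟩ := hF.exists_isSpectralMeasure hd
  obtain ⟨μ₂, h₂⟩ := hF.exists_isSpectralMeasure (hg.sub hd)
  have h₁ : IsSpectralMeasure P F (g + (f - g)) μ := by rwa [add_sub_cancel]
  have hp := congrArg (fun m : Measure (Compacts ℝ) => m Iᶜ) (hν.parallelogram hg hd hν' h₁ h₂)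
  simp only [Measure.add_apply, Measure.smul_apply, hν0, zero_add, smul_eq_mul] at hp
  have hle : μ Iᶜ ≤ 2 * ENNReal.ofReal (∫ x, (f x - g x) ^ 2 ∂P) := by
    calc μ Iᶜ ≤ 2 * ν' Iᶜ := by rw [← hp]; exact le_self_add
      _ ≤ 2 * ν' Set.univ := by gcongr; exact Set.subset_univ _
      _ = _ := by
        have h5 := (isSpectralMeasure_iff hd).1 hν' Set.univ isElementary_univ
        simp only [Set.subset_univ, Set.ofPred_true] at h5
        rw [h5, hF.mass_univ hd]
        rfl
  have hle' := ENNReal.toReal_mono (by finiteness) hle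
  rw [ENNReal.toReal_mul, ENNReal.toReal_ofReal (integral_nonneg fun _ => sq_nonneg _)] at hle'
  norm_num at hle'
  linarith

theorem isSpectralMeasure_condExp (hE : IsElementary E) (hf : MemLp f 2 P)
    (hμ : IsSpectralMeasure P F f μ) :
    IsSpectralMeasure P F (P[f|sigmaField F E])
      (μ.restrict {M : Compacts ℝ | (M : Set ℝ) ⊆ E}) := by
  have := hF.prob
  rw [isSpectralMeasure_iff (memLp_condExp_two hf)]
  intro E' hE'
  rw [Measure.restrict_apply (measurableSet_subsets hE'),
    hF.mass_condExp (hF.isSplitting_of_isElementary hE') E hf,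
    ← (isSpectralMeasure_iff hf).1 hμ _ (hE.inter hE')]
  congr 1
  ext M
  simp [and_comm]

theorem spectrumIn_condExp (hE : IsElementary E) (hf : MemLp f 2 P) (h : SpectrumIn P F f I) :
    SpectrumIn P F (P[f|sigmaField F E]) I := by
  obtain ⟨μ, hμ, h0⟩ := h
  exact ⟨_, hF.isSpectralMeasure_condExp hE hf hμ, Measure.absolutelyContinuous_of_le
    Measure.restrict_le_self h0⟩

/-- Since h² = 1, f ↦ h E(hf | F_{Dᶜ}) is an orthogonal projection. It commutes with conditioning on
F_{E ∪ D}, because h is measurable there, so Pythagoras survives the conditioning. Multiplication by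
h preserves the norm of the first component, which leaves the mass of E(hf | F_{Dᶜ}) at E. -/
theorem mass_eq_add_of_sq_eq_one (hD : IsSplitting F D) (hE : IsSplitting F E) {h : Ω → ℝ}
    (hm : StronglyMeasurable[sigmaField F D] h) (hsq : ∀ x, h x ^ 2 = 1) (hf : MemLp f 2 P) :
    mass P F f (E ∪ D) = mass P F (P[h * f|sigmaField F Dᶜ]) E +
      mass P F (f - h * P[h * f|sigmaField F Dᶜ]) (E ∪ D) := by
  have := hF.prob
  have hbd : ∀ᵐ x ∂P, ‖h x‖ ≤ 1 := Eventually.of_forall fun x => by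
    rw [Real.norm_eq_abs, ← sq_le_one_iff_abs_le_one, hsq x]
  have hmul : ∀ {u : Ω → ℝ}, MemLp u 2 P → MemLp (h * u) 2 P := fun hu =>
    memLp_mul_of_bound (hm.mono (hF.sigmaField_le D)).aestronglyMeasurable hbd hu
  set A := sigmaField F (E ∪ D) with hA
  set K := sigmaField F Dᶜ with hK
  have hAle : A ≤ mΩ := hF.sigmaField_le _
  have hKle : K ≤ mΩ := hF.sigmaField_le _
  have hmA : StronglyMeasurable[A] h := hm.mono (sigmaField_mono Set.subset_union_right)
  have pull : ∀ {u : Ω → ℝ}, MemLp u 2 P → P[h * u|A] =ᵐ[P] h * P[u|A] := fun hu =>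
    condExp_stronglyMeasurable_mul_of_bound hAle hmA (integrable_of_memLp_two hu) 1 hbd
  set g := P[f|A] with hg
  have hgL : MemLp g 2 P := memLp_condExp_two hf
  set t := P[h * g|K] with ht
  have htL : MemLp t 2 P := memLp_condExp_two (hmul hgL)
  have hset1 : (E ∪ D) ∩ Dᶜ = Dᶜ ∩ E := by grind
  have hset2 : Dᶜ ∩ (E ∪ D) = Dᶜ ∩ E := by grind
  -- The function t, obtained by first conditioning f on F_{E ∪ D}, is also what E(hf | F_{Dᶜ})
  -- becomes after conditioning on F_E or on F_{E ∪ D}.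
  have ht1 : t =ᵐ[P] P[h * f|sigmaField F (Dᶜ ∩ E)] := by
    refine (condExp_congr_ae (pull hf).symm).trans ?_
    rw [← hset1]
    exact hF.condExp_condExp hD.compl (E ∪ D) (hmul hf)
  have ht2 : P[P[h * f|K]|sigmaField F E] =ᵐ[P] t :=
    (hF.condExp_condExp hE Dᶜ (hmul hf)).trans ht1.symm
  have ht3 : P[P[h * f|K]|A] =ᵐ[P] t := by
    refine (hF.condExp_condExp (hE.union hD) Dᶜ (hmul hf)).trans ?_
    rw [hset2]
    exact ht1.symm
  have h1 : mass P F (P[h * f|K]) E = ∫ x, t x ^ 2 ∂P := by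
    refine integral_congr_ae ?_
    filter_upwards [ht2] with x hx
    rw [hx]
  have h2 : mass P F (f - h * P[h * f|K]) (E ∪ D) = ∫ x, (g x - (h * t) x) ^ 2 ∂P := by
    refine integral_congr_ae ?_
    have hTL : MemLp (P[h * f|K]) 2 P := memLp_condExp_two (hmul hf)
    filter_upwards [condExp_sub (integrable_of_memLp_two hf) (integrable_of_memLp_two (hmul hTL)) A,
      pull hTL, ht3] with x hx1 hx2 hx3
    rw [hx1, Pi.sub_apply, hx2, Pi.mul_apply, hx3, Pi.mul_apply]
  -- Orthogonality: ⟨g, ht⟩ = ⟨hg, t⟩ = ‖t‖², as t is the projection of hg.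
  have h3 : ∫ x, g x * (h * t) x ∂P = ∫ x, t x ^ 2 ∂P := by
    have := integral_mul_condExp hKle (hmul hgL) (hmul hgL)
    rw [← ht] at this
    simp only [Pi.mul_apply] at this ⊢
    simp only [sq, ← this]
    congr 1
    ext x; ring
  have h4 : ∫ x, (h * t) x ^ 2 ∂P = ∫ x, t x ^ 2 ∂P := by
    simp only [Pi.mul_apply, mul_pow, hsq, one_mul]
  rw [h1, h2, integral_sq_sub hgL (hmul htL), h3, h4]
  change ∫ x, g x ^ 2 ∂P = _
  ring

theorem spectrumIn_condExp_sign_mul (hI : IsCompactIdeal I) (hIm : MeasurableSet I)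
    (hD : IsElementary D)
    (hDc : IsClosed Dᶜ) {h : Ω → ℝ} (hm : StronglyMeasurable[sigmaField F D] h)
    (hsq : ∀ x, h x ^ 2 = 1) (hf : MemLp f 2 P) (hfI : SpectrumIn P F f I) :
    SpectrumIn P F (P[h * f|sigmaField F Dᶜ]) I := by
  have := hF.prob
  have hbd : ∀ᵐ x ∂P, ‖h x‖ ≤ 1 := Eventually.of_forall fun x => by
    rw [Real.norm_eq_abs, ← sq_le_one_iff_abs_le_one, hsq x]
  have hmul : ∀ {u : Ω → ℝ}, MemLp u 2 P → MemLp (h * u) 2 P := fun hu =>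
    memLp_mul_of_bound (hm.mono (hF.sigmaField_le D)).aestronglyMeasurable hbd hu
  have hTL : MemLp (P[h * f|sigmaField F Dᶜ]) 2 P := memLp_condExp_two (hmul hf)
  have hRL := hf.sub (hmul hTL)
  obtain ⟨μ, hμ, hμ0⟩ := hfI
  obtain ⟨μ₁, h₁⟩ := hF.exists_isSpectralMeasure hTL
  obtain ⟨μ₂, h₂⟩ := hF.exists_isSpectralMeasure hRL
  have := hμ.isFiniteMeasure hf
  have htr : Measurable (trace Dᶜ hDc) := measurable_trace hDc (by rwa [compl_compl])
  have hpre : ∀ E : Set ℝ, trace Dᶜ hDc ⁻¹' {M : Compacts ℝ | (M : Set ℝ) ⊆ E} =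
      {M : Compacts ℝ | (M : Set ℝ) ⊆ E ∪ D} := by
    intro E
    have := setOf_trace_subset Dᶜ hDc E
    rwa [compl_compl] at this
  -- As M ∩ Dᶜ ⊆ E means M ⊆ E ∪ D, the mass identity says that μ₁ is dominated by the law of the
  -- trace on Dᶜ of the spectral set of f. That trace is a subset of a member of the ideal.
  have key : μ.map (trace Dᶜ hDc) = μ₁ + μ₂.map (trace Dᶜ hDc) := by
    have := hμ.isFiniteMeasure hf
    refine ext_of_subsetEvents fun E hE => ?_
    rw [Measure.add_apply, Measure.map_apply htr (measurableSet_subsets hE),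
      Measure.map_apply htr (measurableSet_subsets hE), hpre,
      (isSpectralMeasure_iff hf).1 hμ _ (hE.union hD), (isSpectralMeasure_iff hTL).1 h₁ _ hE,
      (isSpectralMeasure_iff hRL).1 h₂ _ (hE.union hD),
      ← ENNReal.ofReal_add (mass_nonneg _ _) (mass_nonneg _ _),
      hF.mass_eq_add_of_sq_eq_one (hF.isSplitting_of_isElementary hD)
        (hF.isSplitting_of_isElementary hE) hm hsq hf]
  refine ⟨μ₁, h₁, ?_⟩
  have h0 : μ.map (trace Dᶜ hDc) Iᶜ = 0 := by
    rw [Measure.map_apply htr hIm.compl]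
    exact measure_mono_null (fun M hM hMI => hM (hI.mono _ M Set.inter_subset_left hMI)) hμ0
  rw [key, Measure.add_apply, add_eq_zero] at h0
  exact h0.1

end IsContinuousFactorization

end Spectrum


/-! ### Traces on a spectral sub-σ-field: the factorization property. -/

section SubFactorization

variable {Ω : Type*} {mΩ : MeasurableSpace Ω} {P : Measure Ω} {F : ℝ → ℝ → MeasurableSpace Ω}
  {f g : Ω → ℝ} {m : MeasurableSpace Ω}

theorem IsSubSigmaField.measurableSet_of_ae_eq (hm : IsSubSigmaField P m) {A B : Set Ω}
    (hA : MeasurableSet[mΩ] A) (hB : MeasurableSet[m] B) (h : A =ᵐ[P] B) : MeasurableSet[m] A := by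
  have hB' := hm.le B hB
  have h1 : MeasurableSet[m] (B \ A) := hm.null _ (hB'.diff hA) (ae_le_set.1 h.symm.le)
  have h2 : MeasurableSet[m] (A \ B) := hm.null _ (hA.diff hB') (ae_le_set.1 h.le)
  have h3 : A = (B \ (B \ A)) ∪ (A \ B) := by grind
  rw [h3]
  exact (hB.diff h1).union h2

theorem IsSubSigmaField.measurable (hm : IsSubSigmaField P m) (hf : Measurable[mΩ] f)
    (h : AEStronglyMeasurable[m] f P) : Measurable[m] f := by
  obtain ⟨f', hf', hff'⟩ := h
  intro B hB
  refine hm.measurableSet_of_ae_eq (hf hB) (hf'.measurable hB) ?_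
  refine Filter.eventuallyEq_set.2 ?_
  filter_upwards [hff'] with x hx
  rw [Set.mem_preimage, Set.mem_preimage, hx]

theorem IsSubSigmaField.measurableSet_of_indicator [IsProbabilityMeasure P]
    (hm : IsSubSigmaField P m) {A : Set Ω} (hA : MeasurableSet[mΩ] A)
    (h : AEStronglyMeasurable[m] (A.indicator fun _ => (1 : ℝ)) P) : MeasurableSet[m] A := by
  have h1 := hm.measurable (measurable_const.indicator hA) h
  have h2 : (A.indicator fun _ => (1 : ℝ)) ⁻¹' {1} = A := by
    ext x
    by_cases hx : x ∈ A <;> simp [hx]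
  rw [← h2]
  exact h1 (measurableSet_singleton 1)

theorem IsSubSigmaField.inf {m' : MeasurableSpace Ω} (hm : IsSubSigmaField P m)
    (hm' : IsSubSigmaField P m') : IsSubSigmaField P (m ⊓ m') :=
  ⟨inf_le_left.trans hm.le, fun N hN h0 => MeasurableSpace.measurableSet_inf.2
    ⟨hm.null N hN h0, hm'.null N hN h0⟩⟩

theorem IsSubSigmaField.aestronglyMeasurable_inf_condExp (hm : IsSubSigmaField P m)
    {X : MeasurableSpace Ω} (hX : X ≤ mΩ) (h : AEStronglyMeasurable[m] (P[f|X]) P) :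
    AEStronglyMeasurable[m ⊓ X] (P[f|X]) P := by
  have hX' : Measurable[X] (P[f|X]) := stronglyMeasurable_condExp.measurable
  have h1 := hm.measurable (hX'.mono hX le_rfl) h
  have h2 : Measurable[m ⊓ X] (P[f|X]) := fun B hB =>
    MeasurableSpace.measurableSet_inf.2 ⟨h1 hB, hX' hB⟩
  exact h2.stronglyMeasurable.aestronglyMeasurable

/-- If all traces `P[1_b f | X]` and `P[1_a f | Y]` belong to smaller fields `X' ≤ X`, `Y' ≤ Y`,
and `f` is orthogonal to `X' ⊔ Y'`, then `f` is orthogonal to `X ⊔ Y`. -/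
theorem setIntegral_inter_eq_zero [IsProbabilityMeasure P] {X Y X' Y' : MeasurableSpace Ω}
    (hX : X ≤ mΩ) (hY : Y ≤ mΩ) (hX' : X' ≤ X) (hY' : Y' ≤ Y) (hf : MemLp f 2 P)
    (hfX : ∀ b, MeasurableSet[Y] b → AEStronglyMeasurable[X'] (P[b.indicator f|X]) P)
    (hfY : ∀ a, MeasurableSet[X] a → AEStronglyMeasurable[Y'] (P[a.indicator f|Y]) P)
    (h : ∀ a b, MeasurableSet[X'] a → MeasurableSet[Y'] b → ∫ x in a ∩ b, f x ∂P = 0)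
    {a b : Set Ω} (ha : MeasurableSet[X] a) (hb : MeasurableSet[Y] b) :
    ∫ x in a ∩ b, f x ∂P = 0 := by
  have hXi : ∀ {a b : Set Ω}, MeasurableSet[X] a → MeasurableSet[Y] b →
      ∫ x in a, (P[b.indicator f|X]) x ∂P = ∫ x in a ∩ b, f x ∂P := by
    intro a b ha hb
    rw [setIntegral_condExp hX ((integrable_of_memLp_two hf).indicator (hY b hb)) ha,
      setIntegral_indicator (hY b hb)]
  have hYi : ∀ {a b : Set Ω}, MeasurableSet[X] a → MeasurableSet[Y] b →
      ∫ x in b, (P[a.indicator f|Y]) x ∂P = ∫ x in a ∩ b, f x ∂P := by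
    intro a b ha hb
    rw [setIntegral_condExp hY ((integrable_of_memLp_two hf).indicator (hX a ha)) hb,
      setIntegral_indicator (hX a ha), Set.inter_comm]
  -- The two factors are enlarged one at a time: here b from Y' to Y with a still in X', and
  -- afterwards a from X' to X.
  have h1 : ∀ a b, MeasurableSet[X'] a → MeasurableSet[Y] b → ∫ x in a ∩ b, f x ∂P = 0 := by
    intro a b ha hb
    have h0 := ae_eq_zero_of_forall_setIntegral_eq_zero (hY'.trans hY) (hfY a (hX' a ha))
      (memLp_condExp_two (hf.indicator (hX a (hX' a ha))))
      (fun b' hb' => by rw [hYi (hX' a ha) (hY' b' hb')]; exact h a b' ha hb')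
    rw [← hYi (hX' a ha) hb, setIntegral_congr_ae (hY b hb) (g := fun _ => 0)]
    · simp
    · filter_upwards [h0] with x hx _ using hx
  have h0 := ae_eq_zero_of_forall_setIntegral_eq_zero (hX'.trans hX) (hfX b hb)
    (memLp_condExp_two (hf.indicator (hY b hb)))
    (fun a' ha' => by rw [hXi (hX' a' ha') hb]; exact h1 a' b ha' hb)
  rw [← hXi ha hb, setIntegral_congr_ae (hX a ha) (g := fun _ => 0)]
  · simp
  · filter_upwards [h0] with x hx _ using hx

theorem setIntegral_sub_condExp [IsProbabilityMeasure P] (hm : m ≤ mΩ) (hf : MemLp f 2 P)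
    {s : Set Ω} (hs : MeasurableSet[m] s) : ∫ x in s, (f - P[f|m]) x ∂P = 0 := by
  simp only [Pi.sub_apply]
  rw [integral_sub (integrable_of_memLp_two hf).integrableOn integrable_condExp.integrableOn,
    setIntegral_condExp hm (integrable_of_memLp_two hf) hs, sub_self]

/-- A σ-field `N` is contained in `m` if all functions that are `N`-measurable and orthogonal to
`m ≤ N` vanish. -/
theorem le_of_forall_orthogonal [IsProbabilityMeasure P] {N : MeasurableSpace Ω}
    (hm : IsSubSigmaField P m) (hN : N ≤ mΩ) (hmN : m ≤ N)
    (h : ∀ f : Ω → ℝ, MemLp f 2 P → StronglyMeasurable[N] f →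
      (∀ s, MeasurableSet[m] s → ∫ x in s, f x ∂P = 0) →
      ∀ s, MeasurableSet[N] s → ∫ x in s, f x ∂P = 0) : N ≤ m := by
  intro A hA
  set f : Ω → ℝ := A.indicator fun _ => (1 : ℝ) with hfdef
  have hf : MemLp f 2 P := memLp_indicator_one (hN A hA) 2
  have hd := hf.sub (memLp_condExp_two (m := m) hf)
  have hdm : StronglyMeasurable[N] (f - P[f|m]) :=
    (stronglyMeasurable_const.indicator hA).sub (stronglyMeasurable_condExp.mono hmN)
  have h0 := ae_eq_zero_of_forall_setIntegral_eq_zero hN hdm.aestronglyMeasurable hd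
    (h _ hd hdm fun s hs => setIntegral_sub_condExp hm.le hf hs)
  refine hm.measurableSet_of_indicator (hN A hA)
    ((stronglyMeasurable_condExp (f := f) (μ := P)).aestronglyMeasurable.congr ?_)
  filter_upwards [h0] with x hx
  simp only [Pi.sub_apply, Pi.zero_apply, sub_eq_zero] at hx
  exact hx.symm

variable {I : Set (Compacts ℝ)} {G : MeasurableSpace Ω}

namespace IsContinuousFactorization

variable (hF : IsContinuousFactorization P F)
include hF

theorem spectrumIn_condExp_interval {r s : ℝ} (hrs : r ≤ s) (hf : MemLp f 2 P)
    (hfI : SpectrumIn P F f I) : SpectrumIn P F (P[f|F r s]) I := by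
  rw [← hF.sigmaField_Icc hrs]
  exact hF.spectrumIn_condExp (isElementary_of_ordConnected Set.ordConnected_Icc) hf hfI

/-- An indicator is (1 + h)/2 with h = ±1, so the sign case and linearity suffice. This is what
makes the orthogonality arguments for the traces work. -/
theorem spectrumIn_condExp_indicator (hI : IsCompactIdeal I) (hIm : MeasurableSet I) {r s : ℝ}
    (hrs : r ≤ s) {b : Set Ω} (hb : MeasurableSet[sigmaField F (Set.Icc r s)ᶜ] b)
    (hf : MemLp f 2 P) (hfI : SpectrumIn P F f I) :
    SpectrumIn P F (P[b.indicator f|F r s]) I := by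
  have := hF.prob
  classical
  set h : Ω → ℝ := b.piecewise (fun _ => 1) (fun _ => -1) with hh
  have hm : StronglyMeasurable[sigmaField F (Set.Icc r s)ᶜ] h :=
    StronglyMeasurable.piecewise hb stronglyMeasurable_const stronglyMeasurable_const
  have hsq : ∀ x, h x ^ 2 = 1 := by
    intro x
    by_cases hx : x ∈ b <;> simp [hh, hx]
  have h1 := hF.spectrumIn_condExp_sign_mul hI hIm
    (isElementary_compl_of_ordConnected Set.ordConnected_Icc)
    (by rw [compl_compl]; exact isClosed_Icc) hm hsq hf hfI
  rw [compl_compl, hF.sigmaField_Icc hrs] at h1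
  have hbd : ∀ᵐ x ∂P, ‖h x‖ ≤ 1 := Eventually.of_forall fun x => by
    rw [Real.norm_eq_abs, ← sq_le_one_iff_abs_le_one, hsq x]
  have hhf : MemLp (h * f) 2 P :=
    memLp_mul_of_bound (hm.mono (hF.sigmaField_le _)).aestronglyMeasurable hbd hf
  have h2 := hF.spectrumIn_condExp_interval hrs hf hfI
  have h3 := (hF.spectrumIn_add (memLp_condExp_two hf) (memLp_condExp_two hhf) h2 h1).smul
    ((memLp_condExp_two hf).add (memLp_condExp_two hhf)) (1 / 2)
  refine h3.congr ?_
  have h4 : b.indicator f = (1 / 2 : ℝ) • (f + h * f) := by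
    ext x
    by_cases hx : x ∈ b <;> simp [hh, hx]
    ring
  rw [h4]
  filter_upwards [condExp_smul (μ := P) (1 / 2 : ℝ) (f + h * f) (F r s),
    condExp_add (integrable_of_memLp_two hf) (integrable_of_memLp_two hhf) (F r s)] with x h5 h6
  rw [h5, Pi.smul_apply, Pi.smul_apply, h6]

/-- A function of G ⊓ F r t orthogonal to both traces jointly is orthogonal to F r s ⊔ F s t: its
integral over a ∩ b is an integral of E(1_b f | F r s) over a, and this function has spectrum in I,
hence belongs to the trace. -/
theorem inf_sup_inf (hI : IsCompactIdeal I) (hIm : MeasurableSet I)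
    (hG : IsSpectralSigmaField P F I G) {r s t : ℝ} (hrs : r ≤ s) (hst : s ≤ t) :
    G ⊓ F r s ⊔ G ⊓ F s t = G ⊓ F r t := by
  have := hF.prob
  have hX := hF.le_space hrs
  have hY := hF.le_space hst
  have hle : G ⊓ F r s ⊔ G ⊓ F s t ≤ G ⊓ F r t :=
    sup_le (inf_le_inf le_rfl (hF.mono le_rfl hrs hst)) (inf_le_inf le_rfl (hF.mono hrs hst le_rfl))
  refine le_antisymm hle ?_
  refine le_of_forall_orthogonal ((hG.sub.inf (hF.sub r s hrs)).of_le le_sup_left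
    (hle.trans (inf_le_left.trans hG.sub.le))) (inf_le_left.trans hG.sub.le) hle ?_
  intro f hf hfm h
  have hfI : SpectrumIn P F f I := (hG.measurable_iff f hf).1
    (hfm.mono inf_le_left).aestronglyMeasurable
  have key := setIntegral_eq_zero_of_isPiSystem (isPiSystem_image2_inter (F r s) (F s t))
    (by rw [← hF.sup r s t hrs hst]; exact sup_eq_generateFrom_image2_inter _ _)
    (hF.le_space (hrs.trans hst)) (integrable_of_memLp_two hf)
    (by simpa using h Set.univ MeasurableSet.univ) (by
      rintro _ ⟨a, ha, b, hb, rfl⟩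
      refine setIntegral_inter_eq_zero (X' := G ⊓ F r s) (Y' := G ⊓ F s t) hX hY inf_le_right
        inf_le_right hf (fun b hb => ?_) (fun a ha => ?_)
        (fun a b ha hb => h _ ?_) ha hb
      · refine hG.sub.aestronglyMeasurable_inf_condExp hX ?_
        refine (hG.measurable_iff _ (memLp_condExp_two (hf.indicator (hY b hb)))).2 ?_
        refine hF.spectrumIn_condExp_indicator hI hIm hrs
          (le_sigmaField (E := (Set.Icc r s)ᶜ) hst (fun x hx hx' => ?_) b hb) hf hfI
        exact (hx.1.trans_le hx'.2).false
      · refine hG.sub.aestronglyMeasurable_inf_condExp hY ?_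
        refine (hG.measurable_iff _ (memLp_condExp_two (hf.indicator (hX a ha)))).2 ?_
        refine hF.spectrumIn_condExp_indicator hI hIm hst
          (le_sigmaField (E := (Set.Icc s t)ᶜ) hrs (fun x hx hx' => ?_) a ha) hf hfI
        exact (hx.2.trans_le hx'.1).false
      · exact MeasurableSet.inter (le_sup_left (a := G ⊓ F r s) _ ha)
          (le_sup_right (a := G ⊓ F r s) _ hb))
  exact fun s hs => key s (inf_le_right (a := G) _ hs)

/-- If f in L₂(G) is orthogonal to every trace, then each E(f | F (r i) (s i)) has spectrum in I, so
it lies in its own trace and vanishes. Directedness makes the union of the fields a π-system. Both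
continuity conditions are instances. -/
theorem inf_iSup_of_directed (hG : IsSpectralSigmaField P F I G) {ι : Type*} [Nonempty ι]
    {r s : ι → ℝ} (hrs : ∀ i, r i ≤ s i) (hd : Directed (· ≤ ·) fun i => F (r i) (s i)) :
    ⨆ i, G ⊓ F (r i) (s i) = G ⊓ ⨆ i, F (r i) (s i) := by
  have := hF.prob
  have hle : ⨆ i, G ⊓ F (r i) (s i) ≤ G ⊓ ⨆ i, F (r i) (s i) :=
    iSup_le fun i => inf_le_inf le_rfl (le_iSup (fun i => F (r i) (s i)) i)
  have hX : ∀ i, F (r i) (s i) ≤ mΩ := fun i => hF.le_space (hrs i)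
  have i₀ : ι := Classical.arbitrary ι
  refine le_antisymm hle ?_
  refine le_of_forall_orthogonal ((hG.sub.inf (hF.sub _ _ (hrs i₀))).of_le
    (le_iSup (fun i => G ⊓ F (r i) (s i)) i₀)
    (hle.trans (inf_le_left.trans hG.sub.le))) (inf_le_left.trans hG.sub.le) hle ?_
  intro f hf hfm h
  have hfI : SpectrumIn P F f I := (hG.measurable_iff f hf).1
    (hfm.mono inf_le_left).aestronglyMeasurable
  have key := setIntegral_eq_zero_of_isPiSystem
    (isPiSystem_iUnion_of_directed_le (fun i => {u | MeasurableSet[F (r i) (s i)] u})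
      (fun i => @MeasurableSpace.isPiSystem_measurableSet _ (F (r i) (s i))) hd)
    (MeasurableSpace.generateFrom_iUnion_measurableSet fun i => F (r i) (s i)).symm
    (iSup_le hX) (integrable_of_memLp_two hf) (by simpa using h Set.univ MeasurableSet.univ) (by
      intro a ha
      obtain ⟨i, hi⟩ := Set.mem_iUnion.1 ha
      have hm := hG.sub.aestronglyMeasurable_inf_condExp (hX i) ((hG.measurable_iff _
        (memLp_condExp_two hf)).2 (hF.spectrumIn_condExp_interval (hrs i) hf hfI))
      have h0 := ae_eq_zero_of_forall_setIntegral_eq_zero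
        (show G ⊓ F (r i) (s i) ≤ mΩ from inf_le_left.trans hG.sub.le) hm (memLp_condExp_two hf) (fun b hb => by
          rw [setIntegral_condExp (hX i) (integrable_of_memLp_two hf)
            (inf_le_right (a := G) _ hb)]
          exact h b (le_iSup (fun i => G ⊓ F (r i) (s i)) i b hb))
      rw [← setIntegral_condExp (hX i) (integrable_of_memLp_two hf) hi,
        setIntegral_congr_ae (hX i a hi) (g := fun _ => 0)]
      · simp
      · filter_upwards [h0] with x hx _ using hx)
  exact fun s hs => key s (inf_le_right (a := G) _ hs)

/-- The traces of a continuous factorization on a spectral sub-σ-field form a continuous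
factorization. -/
theorem inf_of_isSpectralSigmaField (hI : IsCompactIdeal I) (hIm : MeasurableSet I)
    (hG : IsSpectralSigmaField P F I G) :
    IsContinuousFactorization (P.trim hG.sub.le) (fun s t => G ⊓ F s t) where
  prob := by
    have := hF.prob
    exact ⟨by rw [trim_measurableSet_eq hG.sub.le MeasurableSet.univ, measure_univ]⟩
  sub s t hst := by
    refine ⟨inf_le_left, fun N hN h0 => ?_⟩
    rw [trim_measurableSet_eq hG.sub.le hN] at h0
    exact MeasurableSpace.measurableSet_inf.2 ⟨hN, (hF.sub s t hst).null N (hG.sub.le N hN) h0⟩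
  indep r s t hrs hst := by
    rw [Indep_iff]
    intro a b ha hb
    rw [MeasurableSpace.measurableSet_inf] at ha hb
    rw [trim_measurableSet_eq hG.sub.le ha.1, trim_measurableSet_eq hG.sub.le hb.1,
      trim_measurableSet_eq hG.sub.le (ha.1.inter hb.1)]
    exact (Indep_iff _ _ _).1 (hF.indep r s t hrs hst) a b ha.2 hb.2
  sup r s t hrs hst := hF.inf_sup_inf hI hIm hG hrs hst
  inner s t hst := by
    have hne : Nonempty {ε : ℝ // 0 < ε ∧ s + ε ≤ t - ε} :=
      ⟨(t - s) / 2, by constructor <;> linarith⟩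
    have h := hF.inf_iSup_of_directed hG
      (r := fun ε : {ε : ℝ // 0 < ε ∧ s + ε ≤ t - ε} => s + ε) (s := fun ε => t - ε)
      (fun ε => ε.2.2) (by
        intro ε δ
        refine ⟨⟨min ε δ, lt_min ε.2.1 δ.2.1, ?_⟩, ?_, ?_⟩
        · linarith [ε.2.2, min_le_left (ε : ℝ) δ]
        · exact hF.mono (by simp) ε.2.2 (sub_le_sub_left (min_le_left _ _) t)
        · exact hF.mono (by simp) δ.2.2 (sub_le_sub_left (min_le_right _ _) t))
    rw [← hF.inner s t hst, iSup_subtype', iSup_subtype']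
    exact h
  exhaust := by
    have hne : Nonempty {n : ℕ // 1 ≤ n} := ⟨⟨1, le_rfl⟩⟩
    have hpos : ∀ n : ℕ, -(n : ℝ) ≤ n := fun n => by
      linarith [show (0 : ℝ) ≤ n from Nat.cast_nonneg n]
    have hmono : ∀ n k : ℕ, n ≤ k → F (-(n : ℝ)) n ≤ F (-(k : ℝ)) k := by
      intro n k hnk
      have : (n : ℝ) ≤ k := by exact_mod_cast hnk
      exact hF.mono (by linarith) (hpos n) this
    have h := hF.inf_iSup_of_directed hG
      (r := fun n : {n : ℕ // 1 ≤ n} => -((n : ℕ) : ℝ)) (s := fun n => ((n : ℕ) : ℝ))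
      (fun n => hpos n) (by
        intro n k
        refine ⟨⟨max n k, le_max_of_le_left n.2⟩, ?_, ?_⟩
        · exact hmono _ _ (le_max_left _ _)
        · exact hmono _ _ (le_max_right _ _))
    have h2 := hF.exhaust
    rw [iSup_subtype'] at h2 ⊢
    rw [h, h2, inf_eq_left]
    exact hG.sub.le

end IsContinuousFactorization

end SubFactorization


/-! ### Shifts: invariance of the spectral sub-σ-field and the noise axioms. -/

section NoiseShift

variable {Ω : Type*} {m G mΩ : MeasurableSpace Ω} {P : Measure Ω} {F : ℝ → ℝ → MeasurableSpace Ω}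
  {α : ℝ → Ω → Ω} {f g : Ω → ℝ} {I : Set (Compacts ℝ)}

theorem condExp_comp_measurePreserving [IsProbabilityMeasure P] {φ : Ω → Ω}
    (hφ : MeasurePreserving φ P P) (hm : m ≤ mΩ) (hf : MemLp f 2 P) :
    P[f ∘ φ|m.comap φ] =ᵐ[P] P[f|m] ∘ φ := by
  have hm' : m.comap φ ≤ mΩ := (MeasurableSpace.comap_mono hm).trans hφ.measurable.comap_le
  refine (ae_eq_condExp_of_forall_setIntegral_eq hm'
    (integrable_of_memLp_two (hf.comp_measurePreserving hφ)) (fun s _ _ => ?_) ?_ ?_).symm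
  · exact (integrable_of_memLp_two
      ((memLp_condExp_two hf).comp_measurePreserving hφ)).integrableOn
  · rintro _ ⟨s, hs, rfl⟩ -
    have key : ∀ g : Ω → ℝ, AEStronglyMeasurable g P →
        ∫ x in φ ⁻¹' s, (g ∘ φ) x ∂P = ∫ x in s, g x ∂P := by
      intro g hg
      conv_rhs => rw [← hφ.map_eq]
      rw [setIntegral_map (hm s hs) (by rwa [hφ.map_eq]) hφ.aemeasurable]
      rfl
    rw [key _ (memLp_condExp_two hf).1, key _ hf.1,
      setIntegral_condExp hm (integrable_of_memLp_two hf) hs]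
  · exact (stronglyMeasurable_condExp.comp_measurable (comap_measurable φ)).aestronglyMeasurable

theorem le_nullCompletion (hm : m ≤ mΩ) : m ≤ nullCompletion P m :=
  le_inf (fun s hs => ⟨s, hs, EventuallyEq.rfl⟩) hm

theorem IsElementary.preimage_sub {E : Set ℝ} (hE : IsElementary E) (t : ℝ) :
    IsElementary ((fun x => x - t) ⁻¹' E) := by
  obtain ⟨S, hS, hJ, rfl⟩ := hE
  refine ⟨(fun J => (fun x => x - t) ⁻¹' J) '' S, hS.image _, ?_, ?_⟩
  · rintro _ ⟨J, hJS, rfl⟩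
    exact (hJ J hJS).preimage_mono fun a b hab => sub_le_sub_right hab t
  · rw [Set.sUnion_image, Set.preimage_sUnion]

namespace IsNoise

variable (hN : IsNoise P F α)
include hN

theorem comp_neg_ae (t : ℝ) : α t ∘ α (-t) =ᵐ[P] id := by
  have h := hN.add t (-t)
  rw [add_neg_cancel] at h
  exact h.symm.trans hN.zero

theorem comap_le {r s : ℝ} (hrs : r ≤ s) (t : ℝ) : (F r s).comap (α t) ≤ F (r - t) (s - t) := by
  rw [← hN.shift r s t hrs]
  exact le_nullCompletion ((MeasurableSpace.comap_mono (hN.fact.le_space hrs)).trans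
    (hN.preserving t).measurable.comap_le)

theorem comap_sigmaField_le (E : Set ℝ) (t : ℝ) :
    (sigmaField F ((fun x => x - t) ⁻¹' E)).comap (α t) ≤ sigmaField F E := by
  simp only [sigmaField, MeasurableSpace.comap_iSup, iSup_le_iff, and_imp]
  intro r s hrs hE
  refine (hN.comap_le hrs t).trans (le_sigmaField (by linarith) fun x hx => ?_)
  have h1 : x + t ∈ (fun x => x - t) ⁻¹' E := hE ⟨by linarith [hx.1], by linarith [hx.2]⟩
  simpa using h1

/-- The pullback under α t of the field over E + t lies in F_E, so conditioning on the pullback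
gives the smaller norm. Only this inclusion is used; `mass_comp` recovers equality. -/
theorem mass_preimage_le (hf : MemLp f 2 P) (t : ℝ) (E : Set ℝ) :
    mass P F f ((fun x => x - t) ⁻¹' E) ≤ mass P F (f ∘ α t) E := by
  have := hN.fact.prob
  have h1 := integral_condExp_sq_mono (hN.comap_sigmaField_le E t) (hN.fact.sigmaField_le E)
    (hf.comp_measurePreserving (hN.preserving t))
  refine le_trans (le_of_eq ?_) h1
  have hm := hN.fact.sigmaField_le ((fun x => x - t) ⁻¹' E)
  have h2 : ∫ x, ((P[f|sigmaField F ((fun x => x - t) ⁻¹' E)]) (α t x)) ^ 2 ∂P =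
      ∫ x, ((P[f|sigmaField F ((fun x => x - t) ⁻¹' E)]) x) ^ 2 ∂P := by
    have h3 := integral_map (μ := P) (hN.preserving t).aemeasurable
      (f := fun x => ((P[f|sigmaField F ((fun x => x - t) ⁻¹' E)]) x) ^ 2) (by
        rw [(hN.preserving t).map_eq]
        exact (memLp_condExp_two hf).1.pow 2)
    rw [(hN.preserving t).map_eq] at h3
    exact h3.symm
  rw [mass, ← h2]
  refine integral_congr_ae ?_
  filter_upwards [condExp_comp_measurePreserving (hN.preserving t) hm hf] with x hx
  rw [hx, Function.comp_apply]

theorem mass_comp (hf : MemLp f 2 P) (t : ℝ) (E : Set ℝ) :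
    mass P F (f ∘ α t) E = mass P F f ((fun x => x - t) ⁻¹' E) := by
  have hft := hf.comp_measurePreserving (hN.preserving t)
  refine le_antisymm ?_ (hN.mass_preimage_le hf t E)
  -- The inequality for f ∘ α t and the inverse shift is the reverse one, since α t ∘ α (-t) is
  -- almost surely the identity.
  have h1 := hN.mass_preimage_le hft (-t) ((fun x => x - t) ⁻¹' E)
  have h2 : (fun x : ℝ => x - -t) ⁻¹' ((fun x => x - t) ⁻¹' E) = E := by
    ext x; simp
  rw [h2] at h1
  refine h1.trans (le_of_eq (mass_congr ?_ _))
  filter_upwards [hN.comp_neg_ae t] with x hx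
  simp only [Function.comp_apply, id] at hx ⊢
  rw [hx]

theorem spectrumIn_comp (hIm : MeasurableSet I) (hIs : IsShiftInvariant I) (hf : MemLp f 2 P)
    (hfI : SpectrumIn P F f I) (t : ℝ) : SpectrumIn P F (f ∘ α t) I := by
  have := hN.fact.prob
  obtain ⟨μ, hμ, h0⟩ := hfI
  have hsh : Measurable fun M : Compacts ℝ => M.map (fun x : ℝ => x + -t)
      (continuous_add_const (-t)) :=
    (Continuous.compacts_map (continuous_add_const (-t))).measurable
  refine ⟨μ.map fun M : Compacts ℝ => M.map (fun x : ℝ => x + -t) (continuous_add_const (-t)),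
    ?_, ?_⟩
  · rw [isSpectralMeasure_iff (hf.comp_measurePreserving (hN.preserving t))]
    intro E hE
    rw [Measure.map_apply hsh (measurableSet_subsets hE), hN.mass_comp hf,
      ← (isSpectralMeasure_iff hf).1 hμ _ (hE.preimage_sub t)]
    congr 1
    ext M
    change (fun x => x + -t) '' (M : Set ℝ) ⊆ E ↔ (M : Set ℝ) ⊆ (fun x => x - t) ⁻¹' E
    rw [Set.image_subset_iff]
    simp only [sub_eq_add_neg]
  · rw [Measure.map_apply hsh hIm.compl]
    exact measure_mono_null (fun M hM hMI => hM (hIs M hMI (-t))) h0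

theorem measurableSet_preimage (hIm : MeasurableSet I) (hIs : IsShiftInvariant I)
    (hG : IsSpectralSigmaField P F I G) {A : Set Ω} (hA : MeasurableSet[G] A) (t : ℝ) :
    MeasurableSet[G] (α t ⁻¹' A) := by
  have := hN.fact.prob
  have hA' := hG.sub.le A hA
  have hf : MemLp (A.indicator fun _ => (1 : ℝ)) 2 P := memLp_indicator_one hA' 2
  have hft := hf.comp_measurePreserving (hN.preserving t)
  refine hG.sub.measurableSet_of_indicator ((hN.preserving t).measurable hA')
    ((hG.measurable_iff _ hft).2 (hN.spectrumIn_comp hIm hIs hf ((hG.measurable_iff _ hf).1 ?_) t))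
  exact (stronglyMeasurable_const.indicator hA).aestronglyMeasurable

end IsNoise

/-- Exceptional sets are covered by measurable null sets, and all of these belong to m. -/
theorem IsSubSigmaField.ae_trim_iff (hm : IsSubSigmaField P m) {p : Ω → Prop} :
    (∀ᵐ x ∂(P.trim hm.le), p x) ↔ ∀ᵐ x ∂P, p x := by
  refine ⟨fun h => ae_of_ae_trim hm.le h, fun h => ?_⟩
  obtain ⟨N, hpN, hN, hN0⟩ := exists_measurable_superset_of_null (ae_iff.1 h)
  have hN' := hm.null N hN hN0
  rw [ae_iff]
  refine measure_mono_null hpN ?_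
  rwa [trim_measurableSet_eq hm.le hN']

theorem IsNoise.inf_of_isSpectralSigmaField (hN : IsNoise P F α) (hI : IsCompactIdeal I)
    (hIm : MeasurableSet I) (hIs : IsShiftInvariant I) (hG : IsSpectralSigmaField P F I G) :
    IsNoise (P.trim hG.sub.le) (fun s t => G ⊓ F s t) α where
  fact := hN.fact.inf_of_isSpectralSigmaField hI hIm hG
  preserving t := by
    have hmeas : Measurable[G, G] (α t) := fun A hA => hN.measurableSet_preimage hIm hIs hG hA t
    refine @MeasurePreserving.mk Ω Ω G G (α t) _ _ hmeas ?_
    refine @Measure.ext _ G _ _ fun A hA => ?_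
    rw [@Measure.map_apply Ω Ω G G _ _ hmeas _ hA, trim_measurableSet_eq hG.sub.le hA,
      trim_measurableSet_eq hG.sub.le (hmeas hA)]
    exact (hN.preserving t).measure_preimage (hG.sub.le A hA).nullMeasurableSet
  zero := hG.sub.ae_trim_iff.2 hN.zero
  add s t := hG.sub.ae_trim_iff.2 (hN.add s t)
  shift r s t hrs := by
    have hF := hN.fact
    apply le_antisymm
    · rintro B ⟨⟨A', ⟨A, hA, rfl⟩, hBA⟩, hB⟩
      replace hA := MeasurableSpace.measurableSet_inf.1 hA
      refine MeasurableSpace.measurableSet_inf.2 ⟨hB, ?_⟩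
      refine (hF.sub _ _ (by linarith)).measurableSet_of_ae_eq (hG.sub.le B hB)
        (hN.comap_le hrs t _ ⟨A, hA.2, rfl⟩) ?_
      exact hG.sub.ae_trim_iff.1 hBA
    · intro B hB
      replace hB := MeasurableSpace.measurableSet_inf.1 hB
      have hB2 := hB.2
      rw [← hN.shift r s t hrs] at hB2
      obtain ⟨⟨A', ⟨A, hA, rfl⟩, hBA⟩, hB'⟩ := hB2
      refine ⟨⟨α t ⁻¹' A, ⟨A, MeasurableSpace.measurableSet_inf.2 ⟨?_, hA⟩, rfl⟩, ?_⟩, hB.1⟩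
      -- The event A is only known to lie in F r s. Modulo null sets it equals the preimage of B
      -- under α (-t), and G is invariant under all shifts, so A lies in G.
      · refine hG.sub.measurableSet_of_ae_eq (hF.le_space hrs A hA)
          (hN.measurableSet_preimage hIm hIs hG hB.1 (-t)) ?_
        have h1 : α (-t) ⁻¹' B =ᵐ[P] α (-t) ⁻¹' (α t ⁻¹' A) :=
          (hN.preserving (-t)).quasiMeasurePreserving.preimage_ae_eq hBA
        refine EventuallyEq.symm (h1.trans (Filter.eventuallyEq_set.2 ?_))
        filter_upwards [hN.comp_neg_ae t] with x hx
        simp only [Function.comp_apply, id] at hx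
        rw [Set.mem_preimage, Set.mem_preimage, hx]
      · exact hG.sub.ae_trim_iff.2 hBA
  cont A hA := by
    refine (hN.cont A (hG.sub.le A hA)).congr fun t => ?_
    rw [trim_measurableSet_eq hG.sub.le
      (hA.symmDiff (hN.measurableSet_preimage hIm hIs hG hA t))]

end NoiseShift


/-! ### Finite sets of points: cell counts, thinning and measurability. -/

section FiniteCompacts

/-- The indices of the dyadic cells of level `n` that lie in `[-n, n)`. -/
noncomputable def cellWindow (n : ℕ) : Finset ℤ := Finset.Ico (-(n : ℤ) * 2 ^ n) (n * 2 ^ n)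

open Classical in
/-- The number of dyadic cells of level `n` in `[-n, n)` that meet `M`. -/
noncomputable def cellCount (n : ℕ) (M : Compacts ℝ) : ℕ :=
  ((cellWindow n).filter fun k => ∃ x ∈ M, ⌊x * 2 ^ n⌋ = k).card

theorem floor_mem_cellWindow {n : ℕ} {x : ℝ} (h1 : -(n : ℝ) ≤ x) (h2 : x < n) :
    ⌊x * 2 ^ n⌋ ∈ cellWindow n := by
  have h3 : (0 : ℝ) < 2 ^ n := by positivity
  rw [cellWindow, Finset.mem_Ico, Int.le_floor, Int.floor_lt]
  push_cast
  exact ⟨mul_le_mul_of_nonneg_right h1 h3.le, mul_lt_mul_of_pos_right h2 h3⟩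

theorem eventually_floor_mem_cellWindow (x : ℝ) :
    ∀ᶠ n : ℕ in atTop, ⌊x * 2 ^ n⌋ ∈ cellWindow n := by
  obtain ⟨N, hN⟩ := exists_nat_gt |x|
  filter_upwards [eventually_ge_atTop N] with n hn
  have h1 : |x| < n := hN.trans_le (by exact_mod_cast hn)
  rw [abs_lt] at h1
  exact floor_mem_cellWindow h1.1.le h1.2

theorem eventually_floor_ne {x y : ℝ} (hxy : x ≠ y) :
    ∀ᶠ n : ℕ in atTop, ⌊x * 2 ^ n⌋ ≠ ⌊y * 2 ^ n⌋ := by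
  have hd : 0 < |x - y| := abs_pos.2 (sub_ne_zero.2 hxy)
  have h1 : Tendsto (fun n : ℕ => |x - y| * (2 : ℝ) ^ n) atTop atTop :=
    (tendsto_pow_atTop_atTop_of_one_lt one_lt_two).const_mul_atTop hd
  filter_upwards [h1.eventually_ge_atTop 1] with n hn heq
  have h2 := Int.abs_sub_lt_one_of_floor_eq_floor heq
  rw [← sub_mul, abs_mul, abs_of_pos (by positivity : (0 : ℝ) < 2 ^ n)] at h2
  linarith

/-- Finitely many distinct points eventually fall into distinct cells of the window. So the counts
converge to the cardinality, finite or infinite. -/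
theorem eventually_card_le_cellCount {M : Compacts ℝ} {S : Finset ℝ} (hS : (S : Set ℝ) ⊆ M) :
    ∀ᶠ n : ℕ in atTop, S.card ≤ cellCount n M := by
  classical
  have h1 : ∀ᶠ n : ℕ in atTop, ∀ x ∈ S, ⌊x * 2 ^ n⌋ ∈ cellWindow n :=
    (Finset.eventually_all S).2 fun x _ => eventually_floor_mem_cellWindow x
  have h2 : ∀ᶠ n : ℕ in atTop, ∀ x ∈ S, ∀ y ∈ S, x ≠ y → ⌊x * 2 ^ n⌋ ≠ ⌊y * 2 ^ n⌋ := by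
    refine (Finset.eventually_all S).2 fun x _ => (Finset.eventually_all S).2 fun y _ => ?_
    by_cases hxy : x = y
    · exact Eventually.of_forall fun n h => absurd hxy h
    · exact (eventually_floor_ne hxy).mono fun n h _ => h
  filter_upwards [h1, h2] with n hn1 hn2
  refine Finset.card_le_card_of_injOn (fun x => ⌊x * 2 ^ n⌋) (fun x hx => ?_)
    fun x hx y hy hxy => ?_
  · simp only [Finset.coe_filter, Set.mem_ofPred_eq]
    exact ⟨hn1 x hx, x, hS hx, rfl⟩
  · by_contra hne
    exact hn2 x hx y hy hne hxy

theorem cellCount_le_card {M : Compacts ℝ} {S : Finset ℝ} (hS : (M : Set ℝ) ⊆ S) (n : ℕ) :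
    cellCount n M ≤ S.card := by
  classical
  refine (Finset.card_le_card (t := S.image fun x => ⌊x * 2 ^ n⌋) fun k hk => ?_).trans
    Finset.card_image_le
  obtain ⟨x, hx, rfl⟩ := (Finset.mem_filter.1 hk).2
  exact Finset.mem_image_of_mem _ (hS hx)

theorem eventually_cellCount_eq {M : Compacts ℝ} (hM : (M : Set ℝ).Finite) :
    ∀ᶠ n : ℕ in atTop, cellCount n M = (M : Set ℝ).ncard := by
  rw [Set.ncard_eq_toFinset_card _ hM]
  filter_upwards [eventually_card_le_cellCount (M := M) (S := hM.toFinset) (by simp)] with n hn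
  exact (cellCount_le_card (by simp) n).antisymm hn

theorem tendsto_cellCount_atTop {M : Compacts ℝ} (hM : (M : Set ℝ).Infinite) :
    Tendsto (fun n => cellCount n M) atTop atTop := by
  refine tendsto_atTop.2 fun K => ?_
  obtain ⟨S, hS, rfl⟩ := hM.exists_subset_card_eq K
  exact eventually_card_le_cellCount hS

theorem isElementary_floor_notMem (n : ℕ) (s : Finset ℤ) :
    IsElementary {x : ℝ | ⌊x * 2 ^ n⌋ ∉ s} := by
  induction s using Finset.induction_on with
  | empty => simpa using isElementary_univ
  | insert k s _ ih =>
    have h1 : {x : ℝ | ⌊x * 2 ^ n⌋ ∉ insert k s} =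
        {x : ℝ | ⌊x * 2 ^ n⌋ = k}ᶜ ∩ {x : ℝ | ⌊x * 2 ^ n⌋ ∉ s} := by
      ext x; simp
    rw [h1]
    refine IsElementary.inter (isElementary_compl_of_ordConnected ?_) ih
    have h2 : Monotone fun x : ℝ => ⌊x * 2 ^ n⌋ := fun a b hab =>
      Int.floor_le_floor (mul_le_mul_of_nonneg_right hab (by positivity))
    exact (Set.ordConnected_singleton (a := k)).preimage_mono h2

open Classical in
-- Random thinning: keep each cell with weight p and delete it with weight q, independently. The
-- weight of the configurations in which M hits no deleted cell is p to the number of hit cells. The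
-- coefficients are nonnegative, so an inequality between measures on the events {M ⊆ E} passes to
-- integrals of p ^ `cellCount`.
theorem pow_cellCount {p q : ENNReal} (hpq : p + q = 1) (n : ℕ) (M : Compacts ℝ) :
    p ^ cellCount n M = ∑ t ∈ (cellWindow n).powerset, p ^ t.card * q ^ (cellWindow n \ t).card *
      {M : Compacts ℝ | (M : Set ℝ) ⊆ {x : ℝ | ⌊x * 2 ^ n⌋ ∉ cellWindow n \ t}}.indicator 1 M := by
  have h1 : p ^ cellCount n M =
      ∏ k ∈ cellWindow n, (p + q * if ∃ x ∈ M, ⌊x * 2 ^ n⌋ = k then 0 else 1) := by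
    rw [cellCount, ← Finset.prod_const, Finset.prod_filter]
    refine Finset.prod_congr rfl fun k _ => ?_
    -- A hit cell contributes p, a missed one p + q = 1.
    split_ifs <;> simp [hpq]
  rw [h1, Finset.prod_add]
  refine Finset.sum_congr rfl fun t _ => ?_
  rw [Finset.prod_const, Finset.prod_mul_distrib, Finset.prod_const, mul_assoc]
  congr 2
  by_cases h : (M : Set ℝ) ⊆ {x : ℝ | ⌊x * 2 ^ n⌋ ∉ cellWindow n \ t}
  · rw [Set.indicator_of_mem (by exact h)]
    refine Finset.prod_eq_one fun k hk => if_neg ?_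
    rintro ⟨x, hx, rfl⟩
    exact h hx hk
  · rw [Set.indicator_of_notMem (by exact h)]
    obtain ⟨x, hx, hxk⟩ := Set.not_subset.1 h
    simp only [Set.mem_ofPred_eq, not_not] at hxk
    exact Finset.prod_eq_zero hxk (if_pos ⟨x, hx, rfl⟩)

theorem measurable_pow_cellCount {p q : ENNReal} (hpq : p + q = 1) (n : ℕ) :
    Measurable fun M : Compacts ℝ => p ^ cellCount n M := by
  classical
  simp_rw [pow_cellCount hpq n]
  exact Finset.measurable_sum _ fun t _ => (measurable_one.indicator
    (measurableSet_subsets (isElementary_floor_notMem n _))).const_mul _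

theorem lintegral_pow_cellCount_mono {μ ν : Measure (Compacts ℝ)}
    (h : ∀ E, IsElementary E →
      μ {M : Compacts ℝ | (M : Set ℝ) ⊆ E} ≤ ν {M : Compacts ℝ | (M : Set ℝ) ⊆ E})
    {p q : ENNReal} (hpq : p + q = 1) (n : ℕ) :
    ∫⁻ M, p ^ cellCount n M ∂μ ≤ ∫⁻ M, p ^ cellCount n M ∂ν := by
  classical
  simp_rw [pow_cellCount hpq n]
  have hE := fun t : Finset ℤ => isElementary_floor_notMem n (cellWindow n \ t)
  have hm := fun t : Finset ℤ => measurableSet_subsets (hE t)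
  have hm' := fun t : Finset ℤ => (measurable_one (α := ENNReal) (β := Compacts ℝ)).indicator (hm t)
  rw [lintegral_finsetSum _ fun t _ => (hm' t).const_mul _,
    lintegral_finsetSum _ fun t _ => (hm' t).const_mul _]
  refine Finset.sum_le_sum fun t _ => ?_
  rw [lintegral_const_mul _ (hm' t), lintegral_const_mul _ (hm' t),
    lintegral_indicator_one (hm t), lintegral_indicator_one (hm t)]
  exact mul_le_mul_right (h _ (hE t)) _

open Classical in
/-- `p` to the power of the cardinality of `M`. -/
noncomputable def powCard (p : ENNReal) (M : Compacts ℝ) : ENNReal :=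
  if (M : Set ℝ).Finite then p ^ (M : Set ℝ).ncard else 0

theorem tendsto_pow_cellCount {p : ENNReal} (hp : p < 1) (M : Compacts ℝ) :
    Tendsto (fun n => p ^ cellCount n M) atTop (𝓝 (powCard p M)) := by
  by_cases hM : (M : Set ℝ).Finite
  · rw [powCard, if_pos hM]
    refine tendsto_const_nhds.congr' ?_
    filter_upwards [eventually_cellCount_eq hM] with n hn
    rw [hn]
  · rw [powCard, if_neg hM]
    exact (ENNReal.tendsto_pow_atTop_nhds_zero_of_lt_one hp).comp (tendsto_cellCount_atTop hM)

/-- As p increases to 1, p^|M| tends to 1 for finite M and stays 0 for infinite M. The order of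
limits matters: first the dyadic level, then p. -/
theorem tendsto_powCard (M : Compacts ℝ) :
    Tendsto (fun n : ℕ => powCard (1 - 2⁻¹ ^ (n + 1)) M) atTop
      (𝓝 (finiteCompacts.indicator 1 M)) := by
  by_cases hM : (M : Set ℝ).Finite
  · rw [Set.indicator_of_mem (by exact hM)]
    simp only [powCard, if_pos hM]
    have h1 : Tendsto (fun n : ℕ => (1 : ENNReal) - 2⁻¹ ^ (n + 1)) atTop (𝓝 (1 - 0)) :=
      ENNReal.Tendsto.sub tendsto_const_nhds
        ((ENNReal.tendsto_pow_atTop_nhds_zero_of_lt_one (by norm_num)).comp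
          (tendsto_add_atTop_nat 1)) (Or.inl ENNReal.one_ne_top)
    have h2 := ENNReal.Tendsto.pow (n := (M : Set ℝ).ncard) h1
    simpa using h2
  · rw [Set.indicator_of_notMem (by exact hM)]
    simp only [powCard, if_neg hM]
    exact tendsto_const_nhds

theorem one_sub_half_pow_add (n : ℕ) : (1 - 2⁻¹ ^ (n + 1) : ENNReal) + 2⁻¹ ^ (n + 1) = 1 :=
  tsub_add_cancel_of_le (pow_le_one₀ zero_le (by norm_num))

theorem one_sub_half_pow_lt_one (n : ℕ) : (1 - 2⁻¹ ^ (n + 1) : ENNReal) < 1 :=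
  ENNReal.sub_lt_self ENNReal.one_ne_top one_ne_zero (by simp)

theorem measurable_powCard (n : ℕ) : Measurable (powCard (1 - 2⁻¹ ^ (n + 1))) :=
  measurable_of_tendsto_metrizable (fun k => measurable_pow_cellCount (one_sub_half_pow_add n) k)
    (tendsto_pi_nhds.2 fun M => tendsto_pow_cellCount (one_sub_half_pow_lt_one n) M)

theorem measurableSet_finiteCompacts : MeasurableSet finiteCompacts := by
  have h : Measurable (finiteCompacts.indicator (fun _ => (1 : ENNReal))) :=
    measurable_of_tendsto_metrizable measurable_powCard (tendsto_pi_nhds.2 tendsto_powCard)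
  exact (measurable_indicator_const_iff (1 : ENNReal)).1 h

theorem tendsto_lintegral_powCard (μ : Measure (Compacts ℝ)) [IsFiniteMeasure μ] :
    Tendsto (fun n : ℕ => ∫⁻ M, powCard (1 - 2⁻¹ ^ (n + 1)) M ∂μ) atTop
      (𝓝 (μ finiteCompacts)) := by
  rw [← lintegral_indicator_one measurableSet_finiteCompacts]
  refine tendsto_lintegral_of_dominated_convergence (fun _ => 1) measurable_powCard
    (fun n => Eventually.of_forall fun M => ?_) (by simp)
    (Eventually.of_forall tendsto_powCard)
  unfold powCard
  split_ifs
  · exact pow_le_one₀ zero_le (one_sub_half_pow_lt_one n).le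
  · exact zero_le_one

theorem tendsto_lintegral_pow_cellCount (μ : Measure (Compacts ℝ)) [IsFiniteMeasure μ] (n : ℕ) :
    Tendsto (fun k : ℕ => ∫⁻ M, (1 - 2⁻¹ ^ (n + 1)) ^ cellCount k M ∂μ) atTop
      (𝓝 (∫⁻ M, powCard (1 - 2⁻¹ ^ (n + 1)) M ∂μ)) :=
  tendsto_lintegral_of_dominated_convergence (fun _ => 1)
    (fun k => measurable_pow_cellCount (one_sub_half_pow_add n) k)
    (fun _ => Eventually.of_forall fun _ => pow_le_one₀ zero_le (one_sub_half_pow_lt_one n).le)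
    (by simp)
    (Eventually.of_forall fun M => tendsto_pow_cellCount (one_sub_half_pow_lt_one n) M)

/-- The hypothesis compares only the events {M ⊆ E}, which does not give μ ≤ ν. The thinning
expansion carries it over to p^|M|, and two limits reach the finite sets. -/
theorem measure_finiteCompacts_mono {μ ν : Measure (Compacts ℝ)} [IsFiniteMeasure μ]
    [IsFiniteMeasure ν] (h : ∀ E, IsElementary E →
      μ {M : Compacts ℝ | (M : Set ℝ) ⊆ E} ≤ ν {M : Compacts ℝ | (M : Set ℝ) ⊆ E}) :
    μ finiteCompacts ≤ ν finiteCompacts :=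
  le_of_tendsto_of_tendsto' (tendsto_lintegral_powCard μ) (tendsto_lintegral_powCard ν) fun n =>
    le_of_tendsto_of_tendsto' (tendsto_lintegral_pow_cellCount μ n)
      (tendsto_lintegral_pow_cellCount ν n) fun k =>
        lintegral_pow_cellCount_mono h (one_sub_half_pow_add n) k

theorem isCompactIdeal_finiteCompacts : IsCompactIdeal finiteCompacts where
  mono _ _ h h2 := Set.Finite.subset h2 h
  union M₁ M₂ h1 h2 := by
    change ((M₁ ⊔ M₂ : Compacts ℝ) : Set ℝ).Finite
    rw [Compacts.coe_sup]
    exact Set.Finite.union h1 h2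

theorem isShiftInvariant_finiteCompacts : IsShiftInvariant finiteCompacts := fun M hM t => by
  change ((M.map _ (continuous_add_const t) : Compacts ℝ) : Set ℝ).Finite
  rw [Compacts.coe_map]
  exact Set.Finite.image _ hM

end FiniteCompacts

/-! ### Absolute values preserve finite spectra. -/

section Abs

variable {Ω : Type*} {m mΩ : MeasurableSpace Ω} {P : Measure Ω} {F : ℝ → ℝ → MeasurableSpace Ω}
  {f : Ω → ℝ}

theorem integral_condExp_sq_le_abs [IsProbabilityMeasure P] (hf : MemLp f 2 P) :
    ∫ x, (P[f|m]) x ^ 2 ∂P ≤ ∫ x, (P[(fun x => |f x|)|m]) x ^ 2 ∂P := by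
  have hfa : MemLp (fun x => |f x|) 2 P := hf.abs
  refine integral_mono_ae (memLp_condExp_two hf).integrable_sq
    (memLp_condExp_two hfa).integrable_sq ?_
  have hi := integrable_of_memLp_two hf
  have hia := integrable_of_memLp_two hfa
  have h1 : P[f|m] ≤ᵐ[P] P[(fun x => |f x|)|m] :=
    condExp_mono hi hia (Eventually.of_forall fun x => le_abs_self (f x))
  have h2 : P[-f|m] ≤ᵐ[P] P[(fun x => |f x|)|m] :=
    condExp_mono hi.neg hia (Eventually.of_forall fun x => neg_le_abs (f x))
  filter_upwards [h1, h2, condExp_neg f m (μ := P)] with x hx1 hx2 hx3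
  rw [hx3, Pi.neg_apply] at hx2
  exact sq_le_sq' (by linarith) hx1

/-- The inequality |E(f | m)| ≤ E(|f| | m) compares the two spectral measures on {M ⊆ E}, hence on
finite sets. As f and |f| have the same norm, full mass on finite sets is inherited. -/
theorem IsContinuousFactorization.spectrumIn_abs (hF : IsContinuousFactorization P F)
    (hf : MemLp f 2 P) (h : SpectrumIn P F f finiteCompacts) :
    SpectrumIn P F (fun x => |f x|) finiteCompacts := by
  have := hF.prob
  have hfa : MemLp (fun x => |f x|) 2 P := hf.abs
  obtain ⟨μ, hμ, h0⟩ := h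
  obtain ⟨ν, hν⟩ := hF.exists_isSpectralMeasure hfa
  refine ⟨ν, hν, ?_⟩
  have := hμ.isFiniteMeasure hf
  have := hν.isFiniteMeasure hfa
  have hμ' := (isSpectralMeasure_iff hf).1 hμ
  have hν' := (isSpectralMeasure_iff hfa).1 hν
  have hmono := measure_finiteCompacts_mono (μ := μ) (ν := ν) fun E hE => by
    rw [hμ' E hE, hν' E hE]
    exact ENNReal.ofReal_le_ofReal (integral_condExp_sq_le_abs hf)
  have huniv : μ Set.univ = ν Set.univ := by
    have h1 := hμ' _ isElementary_univ
    have h2 := hν' _ isElementary_univ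
    simp only [Set.subset_univ, Set.ofPred_true] at h1 h2
    rw [h1, h2, hF.mass_univ hf, hF.mass_univ hfa]
    simp
  rw [measure_compl measurableSet_finiteCompacts (measure_ne_top _ _), tsub_eq_zero_iff_le,
    ← huniv, ← measure_add_measure_compl measurableSet_finiteCompacts, h0, add_zero]
  exact hmono

end Abs


/-! ### Closed vector lattices in L₂ containing constants, and their σ-fields. -/

section Lattice

variable {Ω : Type*} {G mΩ : MeasurableSpace Ω} {P : Measure Ω} {f g : Ω → ℝ}

theorem exists_simpleFunc_approx {Ω : Type*} [MeasurableSpace Ω] {f : Ω → ℝ}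
    (hf : Measurable f) : ∃ u : ℕ → SimpleFunc Ω ℝ, (∀ n x, |u n x| ≤ 2 * |f x|) ∧
      ∀ x, Tendsto (fun n => u n x) atTop (𝓝 (f x)) := by
  refine ⟨fun n => SimpleFunc.approxOn f hf Set.univ 0 trivial n, fun n x => ?_, fun x =>
    SimpleFunc.tendsto_approxOn hf (Set.mem_univ _) (by simp)⟩
  have h := SimpleFunc.norm_approxOn_zero_le hf (s := Set.univ) trivial x n
  rw [two_mul]
  exact h

theorem memLp_two_of_simpleFunc [IsProbabilityMeasure P] (hG : G ≤ mΩ) (s : @SimpleFunc Ω G ℝ) :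
    MemLp s 2 P := by
  obtain ⟨C, hC⟩ := @SimpleFunc.exists_forall_norm_le Ω ℝ G _ s
  exact MemLp.of_bound ((@SimpleFunc.stronglyMeasurable Ω ℝ G _ s).mono hG).aestronglyMeasurable
    C (Eventually.of_forall hC)

/-- A property of square integrable functions that defines a closed vector lattice in `L₂`
containing the constants. -/
structure IsClosedLattice (P : Measure Ω) (H : (Ω → ℝ) → Prop) : Prop where
  congr : ∀ f g : Ω → ℝ, f =ᵐ[P] g → H f → H g
  one : H fun _ => 1
  smul : ∀ (c : ℝ) (f : Ω → ℝ), MemLp f 2 P → H f → H fun x => c * f x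
  add : ∀ f g : Ω → ℝ, MemLp f 2 P → MemLp g 2 P → H f → H g → H fun x => f x + g x
  abs : ∀ f : Ω → ℝ, MemLp f 2 P → H f → H fun x => |f x|
  closed : ∀ f : Ω → ℝ, MemLp f 2 P →
    (∀ ε > 0, ∃ g, MemLp g 2 P ∧ H g ∧ ∫ x, (f x - g x) ^ 2 ∂P < ε) → H f

namespace IsClosedLattice

variable [IsProbabilityMeasure P] {H : (Ω → ℝ) → Prop} (hH : IsClosedLattice P H)
include hH

theorem const (c : ℝ) : H fun _ => c := by
  simpa using hH.smul c _ (memLp_const 1) hH.one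

theorem sub (hf : MemLp f 2 P) (hg : MemLp g 2 P) (hHf : H f) (hHg : H g) :
    H fun x => f x - g x := by
  have h := hH.add f _ hf (hg.const_mul (-1)) hHf (hH.smul (-1) g hg hHg)
  simpa [← sub_eq_add_neg] using h

theorem max (hf : MemLp f 2 P) (hg : MemLp g 2 P) (hHf : H f) (hHg : H g) :
    H fun x => f x ⊔ g x := by
  have hfg : MemLp (fun x => f x - g x) 2 P := hf.sub hg
  have h := hH.smul 2⁻¹ _ ((hf.add hg).add hfg.abs)
    (hH.add _ _ (hf.add hg) hfg.abs (hH.add _ _ hf hg hHf hHg)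
      (hH.abs _ hfg (hH.sub hf hg hHf hHg)))
  refine hH.congr _ _ (Eventually.of_forall fun x => ?_) h
  simp only [Pi.add_apply, Pi.abs_apply]
  linarith [max_sub_min_eq_abs (f x) (g x), abs_sub_comm (f x) (g x), min_add_max (f x) (g x)]

theorem min (hf : MemLp f 2 P) (hg : MemLp g 2 P) (hHf : H f) (hHg : H g) :
    H fun x => f x ⊓ g x := by
  have h1 : MemLp (fun x => f x ⊔ g x) 2 P := hf.sup hg
  refine hH.congr _ _ (Eventually.of_forall fun x => ?_)
    (hH.sub (f := fun x => f x + g x) (hf.add hg) h1 (hH.add _ _ hf hg hHf hHg)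
      (hH.max hf hg hHf hHg))
  simp only
  linarith [min_add_max (f x) (g x)]

theorem of_tendsto {u : ℕ → Ω → ℝ} {b : Ω → ℝ} (hf : MemLp f 2 P) (hu : ∀ n, MemLp (u n) 2 P)
    (hHu : ∀ n, H (u n)) (hb : MemLp b 2 P) (hub : ∀ n x, |f x - u n x| ≤ b x)
    (hlim : ∀ x, Tendsto (fun n => u n x) atTop (𝓝 (f x))) : H f := by
  refine hH.closed f hf fun ε hε => ?_
  have h1 : Tendsto (fun n => ∫ x, (f x - u n x) ^ 2 ∂P) atTop (𝓝 (∫ _, (0 : ℝ) ∂P)) := by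
    refine tendsto_integral_of_dominated_convergence (fun x => b x ^ 2)
      (fun n => ((hf.1.sub (hu n).1).pow 2)) hb.integrable_sq
      (fun n => Eventually.of_forall fun x => ?_) (Eventually.of_forall fun x => ?_)
    · rw [Real.norm_of_nonneg (sq_nonneg _)]
      exact sq_le_sq' (abs_le.1 (hub n x)).1 (abs_le.1 (hub n x)).2
    · have h2 := ((tendsto_const_nhds (x := f x)).sub (hlim x)).pow 2
      simpa using h2
  rw [integral_zero] at h1
  obtain ⟨n, hn⟩ := (h1.eventually (gt_mem_nhds hε)).exists
  exact ⟨u n, hu n, hHu n, hn⟩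

theorem indicator_union {A B : Set Ω} (hA : MeasurableSet A) (hB : MeasurableSet B)
    (hHA : H (A.indicator fun _ => 1)) (hHB : H (B.indicator fun _ => 1)) :
    H ((A ∪ B).indicator fun _ => 1) := by
  refine hH.congr _ _ (Eventually.of_forall fun x => ?_)
    (hH.max (memLp_indicator_one hA 2) (memLp_indicator_one hB 2) hHA hHB)
  by_cases h1 : x ∈ A <;> by_cases h2 : x ∈ B <;> simp [h1, h2]

theorem indicator_iUnion {A : ℕ → Set Ω} (hA : ∀ n, MeasurableSet (A n))
    (hHA : ∀ n, H ((A n).indicator fun _ => 1)) : H ((⋃ n, A n).indicator fun _ => 1) := by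
  have hacc : ∀ n, MeasurableSet (Set.accumulate A n) ∧
      H ((Set.accumulate A n).indicator fun _ => 1) := by
    intro n
    induction n with
    | zero => simpa using ⟨hA 0, hHA 0⟩
    | succ n ih =>
      rw [Set.accumulate_succ]
      exact ⟨ih.1.union (hA _), hH.indicator_union ih.1 (hA _) ih.2 (hHA _)⟩
  rw [← Set.iUnion_accumulate]
  refine hH.of_tendsto (memLp_indicator_one (MeasurableSet.iUnion fun n => (hacc n).1) 2)
    (fun n => memLp_indicator_one (hacc n).1 2) (fun n => (hacc n).2) (memLp_const 1)
    (fun n x => ?_) fun x => ?_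
  · classical
    rw [Set.indicator_apply, Set.indicator_apply]
    split_ifs <;> simp
  · refine (tendsto_indicator_const_apply_iff_eventually atTop (1 : ℝ) x).2 ?_
    by_cases hx : x ∈ ⋃ n, Set.accumulate A n
    · obtain ⟨n, hn⟩ := Set.mem_iUnion.1 hx
      filter_upwards [eventually_ge_atTop n] with k hk
      simp only [hx, iff_true]
      exact Set.monotone_accumulate hk hn
    · exact Eventually.of_forall fun k =>
        ⟨fun h => absurd (Set.mem_iUnion_of_mem k h) hx, fun h => absurd h hx⟩

/-- The σ-field of all events whose indicators belong to a closed vector lattice. -/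
@[reducible] def eventSpace : MeasurableSpace Ω where
  MeasurableSet' A := MeasurableSet A ∧ H (A.indicator fun _ => 1)
  measurableSet_empty := ⟨MeasurableSet.empty, by simpa using hH.const 0⟩
  measurableSet_compl A hA := ⟨hA.1.compl, by
    refine hH.congr _ _ (Eventually.of_forall fun x => ?_)
      (hH.sub (memLp_const 1) (memLp_indicator_one hA.1 2) hH.one hA.2)
    by_cases hx : x ∈ A <;> simp [hx]⟩
  measurableSet_iUnion A hA :=
    ⟨MeasurableSet.iUnion fun n => (hA n).1, hH.indicator_iUnion (fun n => (hA n).1)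
      fun n => (hA n).2⟩

theorem isSubSigmaField_eventSpace : IsSubSigmaField P hH.eventSpace where
  le _ hA := hA.1
  null N hN h0 := ⟨hN, by
    refine hH.congr _ _ ?_ (hH.const 0)
    have h1 : ∀ᵐ x ∂P, x ∉ N := measure_eq_zero_iff_ae_notMem.1 h0
    filter_upwards [h1] with x hx
    simp [hx]⟩

/-- The indicator of {f > c} is the limit of 1 ∧ n(f - c)⁺, all of which stay in the lattice. -/
theorem measurable_eventSpace (hfm : Measurable f) (hf : MemLp f 2 P) (hHf : H f) :
    Measurable[hH.eventSpace] f := by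
  refine measurable_of_Ioi (mδ := hH.eventSpace) fun c => ⟨hfm measurableSet_Ioi, ?_⟩
  have hc : MemLp (fun x => f x - c) 2 P := hf.sub (memLp_const c)
  have hpos : MemLp (fun x => (f x - c) ⊔ 0) 2 P := hc.sup (memLp_const 0)
  have hHpos : H fun x => (f x - c) ⊔ 0 :=
    hH.max hc (memLp_const 0) (hH.sub hf (memLp_const c) hHf (hH.const c)) (hH.const 0)
  have hn : ∀ n : ℕ, MemLp (fun x => (n : ℝ) * ((f x - c) ⊔ 0)) 2 P := fun n => hpos.const_mul _
  refine hH.of_tendsto (u := fun n x => (1 : ℝ) ⊓ ((n : ℝ) * ((f x - c) ⊔ 0)))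
    (memLp_indicator_one (hfm measurableSet_Ioi) 2) (fun n => (memLp_const 1).inf (hn n))
    (fun n => hH.min (memLp_const 1) (hn n) hH.one (hH.smul _ _ hpos hHpos)) (memLp_const 1)
    (fun n x => ?_) fun x => ?_
  · have h0 : 0 ≤ (1 : ℝ) ⊓ ((n : ℝ) * ((f x - c) ⊔ 0)) :=
      le_inf zero_le_one (mul_nonneg n.cast_nonneg le_sup_right)
    have h1 : (1 : ℝ) ⊓ ((n : ℝ) * ((f x - c) ⊔ 0)) ≤ 1 := inf_le_left
    by_cases hx : x ∈ f ⁻¹' Set.Ioi c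
    · rw [Set.indicator_of_mem hx, abs_le]; constructor <;> linarith
    · rw [Set.indicator_of_notMem hx, abs_le]; constructor <;> linarith
  · by_cases hx : x ∈ f ⁻¹' Set.Ioi c
    · rw [Set.indicator_of_mem hx]
      have hx' : 0 < f x - c := sub_pos.2 hx
      refine tendsto_const_nhds.congr' ?_
      filter_upwards [(tendsto_natCast_atTop_atTop (R := ℝ)).eventually_ge_atTop (f x - c)⁻¹]
        with n hn
      rw [sup_of_le_left hx'.le, inf_of_le_left]
      rwa [inv_le_iff_one_le_mul₀ hx'] at hn
    · rw [Set.indicator_of_notMem hx]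
      have hx' : f x - c ≤ 0 := sub_nonpos.2 (not_lt.1 hx)
      simp [sup_of_le_right hx']

theorem of_simpleFunc (s : @SimpleFunc Ω hH.eventSpace ℝ) : H s := by
  have hle := hH.isSubSigmaField_eventSpace.le
  refine @SimpleFunc.induction Ω ℝ hH.eventSpace _ (fun s => H s) (fun c A hA => ?_)
    (fun s t _ hs ht => ?_) s
  · refine hH.congr _ _ (Eventually.of_forall fun x => ?_)
      (hH.smul c _ (memLp_indicator_one hA.1 2) hA.2)
    by_cases hx : x ∈ A <;> simp [hx]
  · exact hH.add _ _ (memLp_two_of_simpleFunc hle s) (memLp_two_of_simpleFunc hle t) hs ht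

theorem of_measurable_eventSpace (hf : MemLp f 2 P) (hfm : Measurable[hH.eventSpace] f) :
    H f := by
  have hle := hH.isSubSigmaField_eventSpace.le
  obtain ⟨u, hu, hlim⟩ := @exists_simpleFunc_approx Ω hH.eventSpace f hfm
  -- The simple approximants satisfy |u n| ≤ 2|f|, so the errors are dominated by 3|f|.
  refine hH.of_tendsto (u := fun n => u n) (b := fun x => 3 * |f x|) hf
    (fun n => memLp_two_of_simpleFunc hle _) (fun n => hH.of_simpleFunc _)
    (hf.abs.const_mul 3) (fun n x => ?_) hlim
  have h1 := abs_sub (f x) (u n x)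
  have h2 := hu n x
  linarith

theorem exists_isSubSigmaField : ∃ G : MeasurableSpace Ω, IsSubSigmaField P G ∧
    ∀ f : Ω → ℝ, MemLp f 2 P → (AEStronglyMeasurable[G] f P ↔ H f) := by
  refine ⟨hH.eventSpace, hH.isSubSigmaField_eventSpace, fun f hf => ⟨fun h => ?_, fun h => ?_⟩⟩
  · exact hH.congr _ _ h.ae_eq_mk.symm (hH.of_measurable_eventSpace
      ((memLp_congr_ae h.ae_eq_mk).1 hf) h.stronglyMeasurable_mk.measurable)
  · have hmk := hf.1.ae_eq_mk
    exact ⟨hf.1.mk f, (hH.measurable_eventSpace hf.1.stronglyMeasurable_mk.measurable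
      ((memLp_congr_ae hmk).1 hf) (hH.congr _ _ hmk h)).stronglyMeasurable, hmk⟩

end IsClosedLattice

end Lattice


/-! ### The classical sub-noise. -/

section Classical

variable {Ω : Type*} {m G mΩ : MeasurableSpace Ω} {P : Measure Ω} {F : ℝ → ℝ → MeasurableSpace Ω}
  {f : Ω → ℝ} {I : Set (Compacts ℝ)}

theorem condExp_trim [IsProbabilityMeasure P] (hmG : m ≤ G) (hG : G ≤ mΩ)
    (hfm : StronglyMeasurable[G] f) (hf : Integrable f P) :
    (P.trim hG)[f|m] =ᵐ[P] P[f|m] := by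
  have hm := hmG.trans hG
  have hprob : IsProbabilityMeasure (P.trim hG) := 
    ⟨by rw [trim_measurableSet_eq hG MeasurableSet.univ, measure_univ]⟩
  have hsm : StronglyMeasurable[m] ((P.trim hG)[f|m]) := stronglyMeasurable_condExp
  have hint : Integrable ((P.trim hG)[f|m]) P :=
    integrable_of_integrable_trim hG (@integrable_condExp Ω ℝ m G (P.trim hG) f _ _ _)
  refine ae_eq_condExp_of_forall_setIntegral_eq hm hf (fun s _ _ => hint.integrableOn)
    (fun s hs _ => ?_) hsm.aestronglyMeasurable
  rw [setIntegral_trim hG (hsm.mono hmG) (hmG s hs), setIntegral_trim hG hfm (hmG s hs)]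
  exact setIntegral_condExp hmG (hf.trim hG hfm) hs

namespace IsContinuousFactorization

variable (hF : IsContinuousFactorization P F)
include hF

/-- Spectral measures with respect to the traces on a sub-σ-field agree with the original ones. -/
theorem isSpectralMeasure_trim (hG : G ≤ mΩ)
    (hFG : IsContinuousFactorization (P.trim hG) (fun s t => G ⊓ F s t))
    (hf : MemLp f 2 (P.trim hG)) {μ : Measure (Compacts ℝ)}
    (hμ : IsSpectralMeasure P F f μ) :
    IsSpectralMeasure (P.trim hG) (fun s t => G ⊓ F s t) f μ := by
  have := hF.prob
  set F' : ℝ → ℝ → MeasurableSpace Ω := fun s t => G ⊓ F s t with hF'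
  intro E hE
  have hle : ∀ D, sigmaField F' D ≤ sigmaField F D := fun D =>
    sigmaField_le_iff.2 fun s t hst hsub => inf_le_right.trans (le_sigmaField hst hsub)
  obtain ⟨f', hf', hff'⟩ := hf.1
  have hff := ae_eq_of_ae_eq_trim hff'
  have hmem := memLp_of_memLp_trim hG hf
  have hmem' := (memLp_congr_ae hff).1 hmem
  have hEG := hFG.sigmaField_le E
  have hsplit : G ≤ sigmaField F' E ⊔ sigmaField F' Eᶜ := by
    have h := hFG.isSplitting_of_isElementary hE Set.univ
    rwa [hFG.sigmaField_univ, Set.univ_inter, ← Set.compl_eq_univ_sdiff] at h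
  -- G is generated by its traces over E and over Eᶜ, and the latter are independent of the full
  -- field F_E. So for G-measurable functions, conditioning on F_E is the same as conditioning on
  -- the trace field over E.
  have h1 : P[f'|sigmaField F E] =ᵐ[P] P[f'|sigmaField F' E] :=
    condExp_eq_of_indep (hle E) (B := sigmaField F' Eᶜ) ((hFG.sigmaField_le _).trans hG)
      (hF.sigmaField_le E)
      (indep_of_indep_of_le_left (hF.indep_sigmaField disjoint_compl_left) (hle _)) hmem'
      (hf'.mono hsplit).aestronglyMeasurable
  have h2 := condExp_trim hEG hG hf' (integrable_of_memLp_two hmem')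
  have h3 : (P.trim hG)[f|sigmaField F' E] =ᵐ[P.trim hG] (P.trim hG)[f'|sigmaField F' E] :=
    condExp_congr_ae hff'
  rw [hμ E hE, eLpNorm_congr_ae (condExp_congr_ae hff), eLpNorm_congr_ae h3,
    eLpNorm_congr_ae (h1.trans h2.symm),
    eLpNorm_trim hG (stronglyMeasurable_condExp.mono hEG)]

theorem isClassical_inf
    (hG : IsSpectralSigmaField P F finiteCompacts G) :
    IsClassical (P.trim hG.sub.le) (fun s t => G ⊓ F s t) := by
  intro f hf
  have hmem := memLp_of_memLp_trim hG.sub.le hf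
  obtain ⟨f', hf', hff'⟩ := hf.1
  obtain ⟨μ, hμ, h0⟩ := (hG.measurable_iff f hmem).1
    ⟨f', hf', ae_eq_of_ae_eq_trim hff'⟩
  exact ⟨μ, hF.isSpectralMeasure_trim hG.sub.le
    (hF.inf_of_isSpectralSigmaField isCompactIdeal_finiteCompacts measurableSet_finiteCompacts hG)
    hf hμ, h0⟩

/-- A constant is unchanged by every conditioning, so its spectral measure is the unit mass at the
empty set. -/
theorem spectrumIn_one : SpectrumIn P F (fun _ => 1) finiteCompacts := by
  have := hF.prob
  refine ⟨Measure.dirac ⊥, (isSpectralMeasure_iff (memLp_const 1)).2 fun E hE => ?_, ?_⟩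
  · rw [Measure.dirac_apply_of_mem (by simp), mass, condExp_const (hF.sigmaField_le E)]
    simp
  · rw [Measure.dirac_apply' _ measurableSet_finiteCompacts.compl]
    simp [finiteCompacts]

theorem isClosedLattice_spectrumIn :
    IsClosedLattice P fun f => SpectrumIn P F f finiteCompacts := by
  have := hF.prob
  exact
    { congr := fun f g h hf => hf.congr h
      one := hF.spectrumIn_one
      smul := fun c f hf h => h.smul hf c
      add := fun f g hf hg h h' => hF.spectrumIn_add hf hg h h'
      abs := fun f hf h => hF.spectrumIn_abs hf h
      closed := fun f hf h => hF.spectrumIn_of_forall_dist_lt hf h }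

theorem exists_isSpectralSigmaField_finiteCompacts :
    ∃ G : MeasurableSpace Ω, IsSpectralSigmaField P F finiteCompacts G := by
  have := hF.prob
  obtain ⟨G, hG, h⟩ := hF.isClosedLattice_spectrumIn.exists_isSubSigmaField
  exact ⟨G, hG, h⟩

end IsContinuousFactorization

end Classical

end ContFact

theorem theorem6p15 {Ω : Type*} {mΩ : MeasurableSpace Ω} (P : Measure Ω)
    (F : ℝ → ℝ → MeasurableSpace Ω) :
    (ContFact.IsContinuousFactorization P F →
      ∀ (I : Set (Compacts ℝ)), ContFact.IsCompactIdeal I → MeasurableSet I →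
      ∀ (G : MeasurableSpace Ω) (hG : ContFact.IsSpectralSigmaField P F I G),
        ContFact.IsContinuousFactorization (P.trim hG.sub.le) (fun s t => G ⊓ F s t)) ∧
    (∀ α : ℝ → Ω → Ω, ContFact.IsNoise P F α →
      (∀ (I : Set (Compacts ℝ)), ContFact.IsCompactIdeal I → MeasurableSet I →
        ContFact.IsShiftInvariant I →
        ∀ (G : MeasurableSpace Ω) (hG : ContFact.IsSpectralSigmaField P F I G),
          ContFact.IsNoise (P.trim hG.sub.le) (fun s t => G ⊓ F s t) α) ∧
      (∃ (G : MeasurableSpace Ω)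
        (hG : ContFact.IsSpectralSigmaField P F ContFact.finiteCompacts G),
          ContFact.IsNoise (P.trim hG.sub.le) (fun s t => G ⊓ F s t) α ∧
          ContFact.IsClassical (P.trim hG.sub.le) (fun s t => G ⊓ F s t))) := by
  refine ⟨fun hF I hI hIm G hG => hF.inf_of_isSpectralSigmaField hI hIm hG, fun α hN =>
    ⟨fun I hI hIm hIs G hG => hN.inf_of_isSpectralSigmaField hI hIm hIs hG, ?_⟩⟩
  obtain ⟨G, hG⟩ := hN.fact.exists_isSpectralSigmaField_finiteCompacts
  exact ⟨G, hG, hN.inf_of_isSpectralSigmaField ContFact.isCompactIdeal_finiteCompacts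
    ContFact.measurableSet_finiteCompacts ContFact.isShiftInvariant_finiteCompacts hG,
    hN.fact.isClassical_inf hG⟩
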